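/- **Setting.** Let $k\ge 1$ and let $\Lambda$ be a finite, strongly connected $k$-graph with no sources and with $\Lambda^0\neq\emptyset$: a countable small category with a degree functor $d:\Lambda\to\mathbb N^k$ having the factorization property (if $d(\lambda)=m+n$ there are unique $\mu,\nu$ with $\lambda=\mu\nu$, $d(\mu)=m$, $d(\nu)=n$); range and source are denoted $r,s$; $\Lambda^n=d^{-1}(n)$ is finite for all $n\in\mathbb N^k$, $v\Lambda^n=\{\lambda\in\Lambda^n:r(\lambda)=v\}$ is non-empty for all $v\in\Lambda^0$ and $n$, and for all $v,w\in\Lambda^0$ there is $\lambda\in\Lambda$ with $r(\lambda)=v$, $s(\lambda)=w$. Let $A_i(v,w)=\#\{\lambda\in\Lambda^{e_i}:r(\lambda)=v,s(\lambda)=w\}$, $\rho_i$ the spectral radius of $A_i$, $\rho(\Lambda)^n=\prod_i\rho_i^{n_i}$, and let $x^\Lambda$ be the Perron–Frobenius eigenvector ($x^\Lambda_v>0$, $\sum_v x^\Lambda_v=1$, $A_ix^\Lambda=\rho_ix^\Lambda$ for all $i$). Let $\Lambda^\infty$ be the space of infinite paths (degree-preserving functors $x:\Omega_k\to\Lambda$)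 with the topology generated by the cylinder sets $[\lambda]=\{x:x(0,d(\lambda))=\lambda\}$, let $M$ be the Borel probability measure on $\Lambda^\infty$ with $M([\lambda])=\rho(\Lambda)^{-d(\lambda)}x^\Lambda_{s(\lambda)}$, and let $S_\lambda\in B(L^2(\Lambda^\infty,M))$ be the operator with $S_\lambda\chi_{[\eta]}=\rho(\Lambda)^{d(\lambda)/2}\chi_{[\lambda\eta]}$ if $s(\lambda)=r(\eta)$ and $S_\lambda\chi_{[\eta]}=0$ otherwise. (That $x^\Lambda$, $M$, $S_\lambda$ exist is part of the assertion.) Let $\mathscr V_n=\mathrm{span}\{\chi_{[\lambda]}:d(\lambda)=(n,\dots,n)\}$ and $\mathcal W_n=\mathscr V_{n+1}\cap\mathscr V_n^\perp$. For $1\le j\le k$ and $\eta\in\Lambda^{e_1+\cdots+e_{j-1}}$, let $\{(c_j)^{\ell,\eta}\}_{1\le\ell\le\#(s(\eta)\Lambda^{e_j})-1}$ be any orthonormal basis of the orthogonal complement of $\mathrm{span}\{(1,\dots,1)\}$ in $\mathbb C^{s(\eta)\Lambda^{e_j}}$ for the inner product $\langle\vec v,\vec w\rangle=\sum_{e}\overline{v_e}w_eM([\eta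 e])$, and put $f_j^{\ell,\eta}=\sum_{e\in s(\eta)\Lambda^{e_j}}(c_j)^{\ell,\eta}_e\chi_{[\eta e]}$. For $q\in\mathbb N$ let $$\mathcal W_{q,j}=\mathrm{span}\{S_\lambda f_j^{\ell,\eta}:d(\lambda)=(q,\dots,q)\},$$ over all such $\lambda,\eta,\ell$. **Theorem.** (1) For each $j$ the family $(f_j^{\ell,\eta})_{\eta,\ell}$ is orthonormal in $L^2(\Lambda^\infty,M)$, and for all $q\in\mathbb N$ and $1\le j\le k$ the family of the $S_\lambda f_j^{\ell,\eta}$ with $d(\lambda)=(q,\dots,q)$ and $s(\lambda)=r(\eta)$ is orthonormal (for $s(\lambda)\ne r(\eta)$ one has $S_\lambda f_j^{\ell,\eta}=0$). (2) $\mathcal W_{q,j}\perp\mathcal W_{q',j'}$ whenever $qk+j\neq q'k+j'$. (3) $L^2(\Lambda^\infty,M)=\mathscr V_0\oplus\bigoplus_{q\in\mathbb N}\bigoplus_{1\le j\le k}\mathcal W_{q,j}$ as an orthogonal Hilbert space direct sum, and $\mathcal W_q=\bigoplus_{j=1}^k\mathcal W_{q,j}$ for all $q\in\mathbb N$. (4)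 Let $\mathcal B_\Lambda$ be the stationary $k$-Bratteli diagram of $(A_1,\dots,A_k)$. Its infinite path space is identified with $\Lambda^\infty$, and its finite paths $\gamma$ of length $|\gamma|=qk+t$ ($0\le t<k$) with range in level $0$, which form the set $F\mathcal B_\Lambda$, are identified with the $\gamma\in\Lambda$ of degree $(q+1,\dots,q+1,q,\dots,q)$, with $t$ entries $q+1$. For $\delta\in(0,1)$ let $w_\delta(\gamma)=\rho(\Lambda)^{-d(\gamma)/\delta}x^\Lambda_{s(\gamma)}$, and let $d_\delta(x,y)$ be $0$ if $x=y$, $1$ if $r(x)\ne r(y)$, and otherwise $w_\delta(x\wedge y)$, where $x\wedge y$ is the longest common initial segment of $x$ and $y$ in $F\mathcal B_\Lambda$. Assume that $A_1\cdots A_k$ is irreducible and that $w_\delta(\gamma)=\sup\{d_\delta(x,y):x,y\in[\gamma]\}$ for all $\gamma\in F\mathcal B_\Lambda$. Then the limits $$\mu_\delta([\gamma])=\lim_{s\searrow\delta}\frac{\sum_{\lambda\in F\mathcal B_\Lambda,\ \lambda\text{ extends }\gamma}w_\delta(\lambda)^s}{\sum_{\lambda\in F\mathcal B_\Lambda}w_\delta(\lambda)^s}\qquad(\gamma\in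 F\mathcal B_\Lambda)$$ exist and define a finite Borel measure $\mu_\delta$ on $\Lambda^\infty$ (the measure induced by the Dixmier trace), $\mu_\delta=M$, and for all $q\in\mathbb N$ and $1\le j\le k$ $$\mathcal W_{q,j}=\mathrm{span}\{E_\gamma:\gamma\in F\mathcal B_\Lambda,\ |\gamma|=qk+j-1\},$$ where for $\gamma\in F\mathcal B_\Lambda$ with $|\gamma|=qk+j-1$ $$E_\gamma=\mathrm{span}\Big\{\tfrac1{\mu_\delta[\gamma e]}\chi_{[\gamma e]}-\tfrac1{\mu_\delta[\gamma e']}\chi_{[\gamma e']}:e\ne e'\in s(\gamma)\Lambda^{e_j}\Big\}$$ (the eigenspaces of the Laplace–Beltrami operators on $L^2(\Lambda^\infty,\mu_\delta)$). -/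

import Mathlib

open CategoryTheory MeasureTheory Filter Topology
open scoped ENNReal

universe u

/-- A `k`-graph: a countable small category with a degree functor to the monoid `ℕᵏ` that satisfies
the factorization property.  A morphism `f : a ⟶ b` has source `a` and range `b`, and the product
`f g` of the arrows-only picture (defined when the source of `f` is the range of `g`) is the
composite `g ≫ f`. -/
structure KGraph (k : ℕ) (C : Type u) [SmallCategory C] where
  countable_arrows : Countable (Arrow C)
  deg : ∀ {a b : C}, (a ⟶ b) → Fin k → ℕ
  deg_id : ∀ a : C, deg (𝟙 a) = 0
  deg_comp : ∀ {a b c : C} (f : a ⟶ b) (g : b ⟶ c), deg (f ≫ g) = deg g + deg f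
  factorization : ∀ {a b : C} (f : a ⟶ b) (m n : Fin k → ℕ), deg f = m + n →
    ∃! p : Σ c : C, (a ⟶ c) × (c ⟶ b), deg p.2.2 = m ∧ deg p.2.1 = n ∧ p.2.1 ≫ p.2.2 = f

/-- The category `Ω_k`: its objects are the elements of `ℕᵏ`, and there is a unique morphism
`(m, n)`, with range `m` and source `n`, for each pair `m ≤ n`. -/
@[ext]
structure Omega (k : ℕ) where
  coord : Fin k → ℕ

instance Omega.smallCategory (k : ℕ) : SmallCategory (Omega k) where
  Hom n m := PLift (m.coord ≤ n.coord)
  id n := ⟨le_refl n.coord⟩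
  comp f g := ⟨le_trans g.down f.down⟩

namespace KGraph

noncomputable section

section Basic

variable {k : ℕ} {C : Type u} [SmallCategory C] (G : KGraph k C)

/-- The degree of an arrow.  The elements of `Λ` are the terms `p : Arrow C`, with source `p.left`
and range `p.right`. -/
def degree (p : Arrow C) : Fin k → ℕ := G.deg p.hom

/-- The product `p q` of two arrows, defined when the source of `p` is the range of `q`. -/
def mul (p q : Arrow C) (h : p.left = q.right) : Arrow C :=
  Arrow.mk (q.hom ≫ eqToHom h.symm ≫ p.hom)

/-- The vertex `v`, viewed as an arrow of degree `0`. -/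
def vertex (v : C) : Arrow C := Arrow.mk (𝟙 v)

/-- `Λ` is finite: there are finitely many arrows of each degree. -/
def IsFinite : Prop := ∀ n : Fin k → ℕ, {p : Arrow C | G.degree p = n}.Finite

/-- `Λ` has no sources: each vertex is the range of an arrow of each degree. -/
def HasNoSources : Prop :=
  ∀ (v : C) (n : Fin k → ℕ), ∃ p : Arrow C, p.right = v ∧ G.degree p = n

/-- `Λ` is strongly connected: for all vertices `v`, `w` there is an arrow with range `v` and
source `w`. -/
def IsStronglyConnected (_G : KGraph k C) : Prop := ∀ v w : C, Nonempty (w ⟶ v)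

/-- The set `v Λ^{e_j}` of edges of color `j` with range `v`. -/
def Edge (v : C) (j : Fin k) : Type u :=
  {e : Arrow C // e.right = v ∧ G.degree e = Pi.single j 1}

/-- The arrow `p e`, for an edge `e` whose range is the source of `p`. -/
def extend {j : Fin k} (p : Arrow C) (e : G.Edge p.left j) : Arrow C :=
  mul p e.1 e.2.1.symm

/-- The adjacency matrices `A_i`. -/
def adj (i : Fin k) : Matrix C C ℕ :=
  fun v w => Nat.card {f : w ⟶ v // G.deg f = Pi.single i 1}

/-- An infinite path: a degree-preserving functor `Ω_k → Λ`. -/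
structure InfPath extends CategoryTheory.Functor (Omega k) C where
  deg_map : ∀ {n m : Omega k} (f : n ⟶ m),
    G.deg (map f) = n.coord - m.coord

/-- The initial segment `x(0, n)` of an infinite path. -/
def seg (x : G.InfPath) (n : Fin k → ℕ) : Arrow C :=
  Arrow.mk (x.map (X := ⟨n⟩) (Y := ⟨0⟩) ⟨fun i => Nat.zero_le (n i)⟩)

/-- The cylinder set `[p]`. -/
def cyl (p : Arrow C) : Set G.InfPath := {x | G.seg x (G.degree p) = p}

/-- The topology on the infinite path space, generated by the cylinder sets. -/
instance : TopologicalSpace G.InfPath := TopologicalSpace.generateFrom (Set.range G.cyl)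

instance : MeasurableSpace G.InfPath := borel G.InfPath

instance : BorelSpace G.InfPath := ⟨rfl⟩

theorem measurableSet_cyl (p : Arrow C) : MeasurableSet (G.cyl p) :=
  (TopologicalSpace.isOpen_generateFrom_of_mem (Set.mem_range_self p)).measurableSet

end Basic

section Measure

variable {k : ℕ} {C : Type u} [SmallCategory C] [Fintype C] [DecidableEq C] (G : KGraph k C)

/-- The spectral radius `ρ_i` of the adjacency matrix `A_i`. -/
def rho (i : Fin k) : ℝ :=
  (spectralRadius ℂ ((G.adj i).map (Nat.cast : ℕ → ℂ))).toReal

/-- `ρ(Λ)^n` for `n ∈ ℕᵏ`. -/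
def rhoPow (n : Fin k → ℕ) : ℝ := ∏ i, G.rho i ^ n i

/-- `x` is the Perron-Frobenius eigenvector: a positive vector with entries of sum `1` that
satisfies `A_i x = ρ_i x` for all `i`. -/
def IsPerronFrobenius (x : C → ℝ) : Prop :=
  (∀ v, 0 < x v) ∧ ∑ v, x v = 1 ∧
    ∀ i, ((G.adj i).map (Nat.cast : ℕ → ℝ)).mulVec x = G.rho i • x

open Classical in
/-- The Perron-Frobenius eigenvector `x^Λ`. -/
def pfVector : C → ℝ := if h : ∃ x, G.IsPerronFrobenius x then h.choose else 0

/-- `μ` is a Borel probability measure with `μ [p] = ρ(Λ)^{-d(p)} x^Λ_{s(p)}` for all `p ∈ Λ`. -/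
def IsPathMeasure (μ : Measure G.InfPath) : Prop :=
  IsProbabilityMeasure μ ∧
    ∀ p, μ (G.cyl p) = ENNReal.ofReal ((G.rhoPow (G.degree p))⁻¹ * G.pfVector p.left)

open Classical in
/-- The measure `M` on the infinite path space. -/
def M : Measure G.InfPath := if h : ∃ μ, G.IsPathMeasure μ then h.choose else 0

instance : IsFiniteMeasure G.M := by
  unfold M
  split_ifs with h
  · have := h.choose_spec.1
    infer_instance
  · infer_instance

/-- The Hilbert space `L²(Λ^∞, M)` of complex-valued functions. -/
abbrev L2 : Type u := Lp ℂ 2 G.M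

/-- The characteristic function of the cylinder set `[p]`, as an element of `L²(Λ^∞, M)`. -/
def chi (p : Arrow C) : G.L2 :=
  indicatorConstLp 2 (G.measurableSet_cyl p) (measure_ne_top G.M (G.cyl p)) 1

/-- `T` is the operator `S_p`: it sends `χ_[q]` to `ρ(Λ)^{d(p)/2} χ_[pq]` if the source of `p` is
the range of `q`, and to `0` otherwise. -/
def IsScalingOperator (p : Arrow C) (T : G.L2 →L[ℂ] G.L2) : Prop :=
  ∀ q : Arrow C,
    (∀ h : p.left = q.right,
      T (G.chi q) = ((Real.sqrt (G.rhoPow (G.degree p)) : ℝ) : ℂ) • G.chi (mul p q h)) ∧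
    (p.left ≠ q.right → T (G.chi q) = 0)

open Classical in
/-- The bounded operator `S_p` on `L²(Λ^∞, M)`. -/
def S (p : Arrow C) : G.L2 →L[ℂ] G.L2 :=
  if h : ∃ T, G.IsScalingOperator p T then h.choose else 0

/-- The space `𝒱_n`, spanned by the `χ_[p]` with `d(p) = (n, …, n)`. -/
def V (n : ℕ) : Submodule ℂ G.L2 :=
  Submodule.span ℂ {f | ∃ p : Arrow C, G.degree p = (fun _ => n) ∧ f = G.chi p}

/-- The wavelet space `𝒲_n = 𝒱_{n+1} ∩ 𝒱_n^⊥`. -/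
def W (n : ℕ) : Submodule ℂ G.L2 := G.V (n + 1) ⊓ (G.V n)ᗮ

/-- The degree `e_1 + ⋯ + e_{j-1}`; colors are numbered from `0` here, so this is the sum of the
`e_i` over all colors `i < j`. -/
def initDeg (j : Fin k) : Fin k → ℕ := fun i => if i < j then 1 else 0

/-- The inner product `∑_e conj(a_e) b_e M([η e])` on `ℂ^{s(η)Λ^{e_j}}`. -/
def edgeInner {j : Fin k} (η : Arrow C) (a b : G.Edge η.left j → ℂ) : ℂ :=
  ∑ᶠ e : G.Edge η.left j,
    (starRingEnd ℂ) (a e) * b e * ((G.M.real (G.cyl (G.extend η e)) : ℝ) : ℂ)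

/-- A family of coefficient vectors `(c_j)^{ℓ,η}`, where `ℓ` takes `#(s(η)Λ^{e_j}) - 1` values. -/
abbrev CoeffFamily : Type u :=
  ∀ (j : Fin k) (η : Arrow C), Fin (Nat.card (G.Edge η.left j) - 1) → G.Edge η.left j → ℂ

/-- For each `j` and each `η` of degree `e_1 + ⋯ + e_{j-1}`, the vectors `(c_j)^{ℓ,η}` form an
orthonormal basis of the orthogonal complement of `span {(1, …, 1)}`. -/
def IsWaveletCoeff (c : G.CoeffFamily) : Prop :=
  ∀ (j : Fin k) (η : Arrow C), G.degree η = initDeg j →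
    (∀ l l', G.edgeInner η (c j η l) (c j η l') = if l = l' then 1 else 0) ∧
    (∀ b : G.Edge η.left j → ℂ,
      b ∈ Submodule.span ℂ (Set.range (c j η)) ↔ G.edgeInner η (fun _ => 1) b = 0)

/-- The mother wavelet `f_j^{ℓ,η} = ∑_e (c_j)^{ℓ,η}_e χ_[η e]`. -/
def mother (c : G.CoeffFamily) (j : Fin k) (η : Arrow C)
    (l : Fin (Nat.card (G.Edge η.left j) - 1)) : G.L2 :=
  ∑ᶠ e : G.Edge η.left j, c j η l e • G.chi (G.extend η e)

/-- The indices `(η, ℓ)` of the mother wavelets `f_j^{ℓ,η}`. -/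
structure MotherIndex (j : Fin k) where
  base : Arrow C
  degree_base : G.degree base = initDeg j
  idx : Fin (Nat.card (G.Edge base.left j) - 1)

/-- The indices `(p, η, ℓ)` of the scaled translates `S_p f_j^{ℓ,η}` with `d(p) = (q, …, q)` for
which `p η` is defined (the other ones vanish). -/
structure WaveletIndex (q : ℕ) (j : Fin k) extends G.MotherIndex j where
  path : Arrow C
  degree_path : G.degree path = fun _ => q
  composable : path.left = base.right

/-- The space `𝒲_{q,j}`, spanned by all `S_p f_j^{ℓ,η}` with `d(p) = (q, …, q)`. -/
def refinedW (c : G.CoeffFamily) (q : ℕ) (j : Fin k) : Submodule ℂ G.L2 :=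
  Submodule.span ℂ {f | ∃ (p : Arrow C) (i : G.MotherIndex j),
    G.degree p = (fun _ => q) ∧ f = G.S p (G.mother c j i.base i.idx)}

/-- The summands `𝒱_0` (for `none`) and `𝒲_{q,j}` (for `some (q, j)`). -/
def summand (c : G.CoeffFamily) : Option (ℕ × Fin k) → Submodule ℂ G.L2
  | none => G.V 0
  | some (q, j) => G.refinedW c q j

end Measure

section Bratteli

variable {k : ℕ} {C : Type u} [SmallCategory C] [Fintype C] [DecidableEq C] (G : KGraph k C)

/-- The degree of a path of length `n` in the stationary `k`-Bratteli diagram, whose edges have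
colors `1, …, k, 1, …, k, …`: if `n = qk + t` with `0 ≤ t < k`, it is
`(q + 1, …, q + 1, q, …, q)`, with `t` entries `q + 1`. -/
def rainbow (k n : ℕ) : Fin k → ℕ := fun i => n / k + if (i : ℕ) < n % k then 1 else 0

/-- The length of an arrow. -/
def length (p : Arrow C) : ℕ := ∑ i, G.degree p i

/-- By the factorization property, the finite paths of length `n` in the Bratteli diagram `ℬ_Λ`
with range in its level `0` are the arrows of degree `rainbow k n`. -/
def IsRainbow (p : Arrow C) : Prop := G.degree p = rainbow k (G.length p)

/-- The set `Fℬ_Λ` of finite paths in the Bratteli diagram. -/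
def FB : Set (Arrow C) := {p | G.IsRainbow p}

/-- The set `F_γ ℬ_Λ` of finite paths in the Bratteli diagram that extend `γ`. -/
def FBExt (γ : Arrow C) : Set (Arrow C) :=
  {p | G.IsRainbow p ∧ ∃ (r : Arrow C) (h : γ.left = r.right), mul γ r h = p}

/-- The function `w_δ (p) = ρ(Λ)^{-d(p)/δ} x^Λ_{s(p)}`. -/
def weight (δ : ℝ) (p : Arrow C) : ℝ := G.rhoPow (G.degree p) ^ (-1 / δ) * G.pfVector p.left

open Classical in
/-- The ultrametric `d_δ` on the infinite path space of `ℬ_Λ`, identified with `Λ^∞`: for `x ≠ y`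
it is `1` if `x` and `y` have different ranges, and otherwise it is `w_δ(x ∧ y)`, where `x ∧ y` is
the longest finite path in `ℬ_Λ` which is an initial segment of both `x` and `y`. -/
def ultraDist (δ : ℝ) (x y : G.InfPath) : ℝ :=
  if x = y then 0
  else if G.seg x 0 ≠ G.seg y 0 then 1
  else G.weight δ (G.seg x (rainbow k (sSup {n | G.seg x (rainbow k n) = G.seg y (rainbow k n)})))

/-- The hypothesis `w_δ(γ) = diam [γ]` for all `γ ∈ Fℬ_Λ`, where
`diam [γ] = sup {d_δ(x, y) | x, y ∈ [γ]}`. -/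
def WeightEqDiam (δ : ℝ) : Prop :=
  ∀ γ ∈ G.FB, IsLUB {t : ℝ | ∃ x ∈ G.cyl γ, ∃ y ∈ G.cyl γ, t = G.ultraDist δ x y} (G.weight δ γ)

/-- The zeta function `ζ_δ(s) = ∑_{γ ∈ Fℬ_Λ} w_δ(γ)^s`. -/
def zeta (δ s : ℝ) : ℝ≥0∞ := ∑' p : G.FB, ENNReal.ofReal (G.weight δ p.1 ^ s)

/-- `μ` is the finite measure induced by the Dixmier trace:
`μ [γ] = lim_{s ↘ δ} (∑_{p ∈ F_γ ℬ_Λ} w_δ(p)^s) / ζ_δ(s)` for all `γ ∈ Fℬ_Λ`. -/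
def IsDixmierMeasure (δ : ℝ) (μ : Measure G.InfPath) : Prop :=
  IsFiniteMeasure μ ∧ ∀ γ ∈ G.FB,
    Tendsto (fun s : ℝ => (∑' p : G.FBExt γ, ENNReal.ofReal (G.weight δ p.1 ^ s)) / G.zeta δ s)
      (𝓝[>] δ) (𝓝 (μ (G.cyl γ)))

open Classical in
/-- The measure `μ_δ` induced by the Dixmier trace. -/
def dixmierMeasure (δ : ℝ) : Measure G.InfPath :=
  if h : ∃ μ, G.IsDixmierMeasure δ μ then h.choose else 0

/-- The space `E_γ`, for a finite path `γ` in the Bratteli diagram: the span of the functions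
`χ_[γe] / μ_δ[γe] - χ_[γe'] / μ_δ[γe']`, where `e ≠ e'` are edges of the Bratteli diagram whose
range is the source of `γ` (their color is determined by the length of `γ`). -/
def eigenspace [NeZero k] (δ : ℝ) (γ : Arrow C) : Submodule ℂ G.L2 :=
  Submodule.span ℂ {f | ∃ e e' : G.Edge γ.left (Fin.ofNat k (G.length γ)), e ≠ e' ∧
    f = ((((G.dixmierMeasure δ).real (G.cyl (G.extend γ e)))⁻¹ : ℝ) : ℂ) • G.chi (G.extend γ e)
      - ((((G.dixmierMeasure δ).real (G.cyl (G.extend γ e')))⁻¹ : ℝ) : ℂ) •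
          G.chi (G.extend γ e')}

end Bratteli

end

end KGraph

/-! The colors are used cyclically, one at a time. The degrees `rainbow k n` form a chain in ℕ^k in
which consecutive members differ by one generator, and `rainbow k (q * k)` is (q,…,q). Let `cylSpan
n` be the span of the χ_[γ] with d(γ) = `rainbow k n`. Since χ_[γ] = ∑_e χ_[γe], these
finite-dimensional spaces increase; they contain every 𝒱_q, and their union is dense. For n = qk + j
(colors numbered from 0) the increment from n to n + 1 is `detailSpace n j`, spanned by the
combinations ∑_e b_e χ_[γe] of integral zero. A path γ of that length factors uniquely as λη with
d(λ) = (q,…,q), and S_λ carries integral-zero combinations over the [ηe] to such combinations over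
the [ληe]. So the increment is 𝒲_{q,j} (`refinedW_eq`), from which orthogonality and both
decompositions follow. Once μ_δ = M, the spaces E_γ are the same integral-zero spaces
(`eigenspace_eq_detail`).

Existence of the data: unique factorization makes the A_i commute, so the Perron vector of a
positive matrix commuting with them is a common eigenvector. M is an ultrafilter limit of discrete
measures on a compact space. S_λ is a weighted composition with the shift by d(λ).

Dixmier measure: along an ultrafilter finer than s ↘ δ the quotients of zeta sums have limits m(γ),
because [0,∞] is compact. The zeta function diverges at δ, so single terms are negligible and m is
additive. Prefixing a path of degree (q,…,q) scales all weights by one factor, so m(γ) =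
ρ(Λ)^{-d(γ)} m(s(γ)) for diagonal γ. Hence the values at vertices form an eigenvector of the
irreducible matrix A_1⋯A_k and must be x^Λ (`eq_mass`). All ultrafilter limits agree, so the limits
exist and equal M[γ]. The diameter hypothesis serves to exclude ρ_1⋯ρ_k = 1; this makes the zeta
function finite for s > δ. -/

namespace KGraph

noncomputable section

/-! ### Unique factorization and initial segments -/

section Arrows

variable {k : ℕ} {C : Type u} [SmallCategory C] (G : KGraph k C)

@[simp] theorem mul_left (p q : Arrow C) (h : p.left = q.right) : (mul p q h).left = q.left := rfl

@[simp] theorem vertex_left (v : C) : (vertex v).left = v := rfl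

@[simp] theorem degree_vertex (v : C) : G.degree (vertex v) = 0 := G.deg_id v

@[simp] theorem degree_mul (p q : Arrow C) (h : p.left = q.right) :
    G.degree (mul p q h) = G.degree p + G.degree q := by
  obtain ⟨a, b, f⟩ := p
  obtain ⟨c, d, g⟩ := q
  change a = d at h
  subst h
  simp only [degree, mul]
  simpa using G.deg_comp g f

theorem mul_assoc (p q r : Arrow C) (h : p.left = q.right) (h' : q.left = r.right) :
    mul (mul p q h) r h' = mul p (mul q r h') h := by
  simp [mul]

@[simp] theorem vertex_mul (v : C) (p : Arrow C) (h : (vertex v).left = p.right) :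
    mul (vertex v) p h = p := by
  obtain ⟨a, b, f⟩ := p
  change v = b at h
  subst h
  simp only [mul, vertex]
  erw [Category.id_comp, Category.comp_id]
  rfl

@[simp] theorem mul_vertex (v : C) (p : Arrow C) (h : p.left = (vertex v).right) :
    mul p (vertex v) h = p := by
  obtain ⟨a, b, f⟩ := p
  change a = v at h
  subst h
  simp only [mul, vertex]
  erw [Category.id_comp, Category.id_comp]
  rfl

variable {G}

theorem exists_mul_eq {p : Arrow C} {m n : Fin k → ℕ} (hp : G.degree p = m + n) :
    ∃ (a b : Arrow C) (h : a.left = b.right), G.degree a = m ∧ G.degree b = n ∧ mul a b h = p := by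
  obtain ⟨⟨c, f, g⟩, ⟨h1, h2, h3⟩, -⟩ := G.factorization p.hom m n hp
  refine ⟨Arrow.mk g, Arrow.mk f, rfl, h1, h2, ?_⟩
  simp only [mul]
  simp only [Arrow.mk_left, Arrow.mk_right, Arrow.mk_hom, eqToHom_refl, Category.id_comp]
  simp only at h3 ⊢
  rw [h3]
  rfl

/-- The uniqueness half of the factorization property. It suffices to compare the degrees of the
left factors, since those of the right factors then agree by cancellation in ℕ^k. -/
theorem mul_inj {a b a' b' : Arrow C} {h : a.left = b.right} {h' : a'.left = b'.right}
    (e : mul a b h = mul a' b' h') (ha : G.degree a = G.degree a') : a = a' ∧ b = b' := by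
  have hb : G.degree b = G.degree b' := by
    have := congrArg G.degree e
    rw [degree_mul, degree_mul, ha] at this
    exact add_left_cancel this
  obtain ⟨x, y, f⟩ := a
  obtain ⟨z, x', g⟩ := b
  obtain ⟨x2, y2, f2⟩ := a'
  obtain ⟨z2, x2', g2⟩ := b'
  change x = x' at h
  change x2 = x2' at h'
  subst h h'
  obtain rfl : z = z2 := congrArg Arrow.left e
  obtain rfl : y = y2 := congrArg Arrow.right e
  simp only [mul] at e
  have e' := Arrow.mk_injective _ _ e
  simp only [eqToHom_refl, Category.id_comp] at e'
  change g ≫ f = g2 ≫ f2 at e'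
  have key := (G.factorization (g ≫ f) (G.deg f) (G.deg g) (G.deg_comp g f)).unique
    (y₁ := ⟨x, g, f⟩) (y₂ := ⟨x2, g2, f2⟩) ⟨rfl, rfl, rfl⟩ ⟨ha.symm, hb.symm, e'.symm⟩
  cases key
  exact ⟨rfl, rfl⟩

/-- Such a `p` has two factorizations, with its source as right factor and with its range as left
factor, and in both the left factor has degree 0. -/
theorem eq_vertex_of_degree_eq_zero {p : Arrow C} (hp : G.degree p = 0) : p = vertex p.left := by
  have := mul_inj (G := G) (a := p) (b := vertex p.left) (a' := vertex p.right) (b' := p)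
    (h := rfl) (h' := rfl) ((mul_vertex _ _ rfl).trans (vertex_mul _ _ rfl).symm) (by simp [hp])
  exact this.2.symm

/-- `a` is an initial segment of `p`. -/
def IsPrefix (a p : Arrow C) : Prop := ∃ (r : Arrow C) (h : a.left = r.right), mul a r h = p

theorem isPrefix_mul (a r : Arrow C) (h : a.left = r.right) : IsPrefix a (mul a r h) := ⟨r, h, rfl⟩

theorem IsPrefix.refl (a : Arrow C) : IsPrefix a a := ⟨vertex a.left, rfl, mul_vertex _ _ rfl⟩

theorem IsPrefix.trans {a b c : Arrow C} (h : IsPrefix a b) (h' : IsPrefix b c) :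
    IsPrefix a c := by
  obtain ⟨r, hr, rfl⟩ := h
  obtain ⟨s, hs, rfl⟩ := h'
  exact ⟨mul r s hs, hr, (mul_assoc a r s hr hs).symm⟩

theorem IsPrefix.right_eq {a b : Arrow C} (h : IsPrefix a b) : a.right = b.right := by
  obtain ⟨r, hr, rfl⟩ := h
  rfl

theorem IsPrefix.degree_le {a b : Arrow C} (h : IsPrefix a b) : G.degree a ≤ G.degree b := by
  obtain ⟨r, hr, rfl⟩ := h
  rw [degree_mul]
  exact le_self_add

theorem IsPrefix.eq_of_degree_eq {a b c : Arrow C} (ha : IsPrefix a c) (hb : IsPrefix b c)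
    (h : G.degree a = G.degree b) : a = b := by
  obtain ⟨r, hr, rfl⟩ := ha
  obtain ⟨s, hs, e⟩ := hb
  exact (mul_inj e h.symm).1.symm

theorem exists_isPrefix_degree {p : Arrow C} {n : Fin k → ℕ} (h : n ≤ G.degree p) :
    ∃ a, IsPrefix a p ∧ G.degree a = n := by
  obtain ⟨a, b, hab, ha, -, e⟩ := exists_mul_eq (G := G) (add_tsub_cancel_of_le h).symm
  exact ⟨a, ⟨b, hab, e⟩, ha⟩

/-- The initial segment of `b` with the degree of `a` is also one of `c`, and `c` has only one of
that degree. -/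
theorem IsPrefix.of_degree_le {a b c : Arrow C} (ha : IsPrefix a c) (hb : IsPrefix b c)
    (h : G.degree a ≤ G.degree b) : IsPrefix a b := by
  obtain ⟨a', ha', e⟩ := exists_isPrefix_degree h
  rwa [ha.eq_of_degree_eq (ha'.trans hb) e.symm]

theorem IsPrefix.exists_hom {a p : Arrow C} (h : IsPrefix a p) :
    ∃ f : p.left ⟶ a.left, mul a (Arrow.mk f) rfl = p := by
  obtain ⟨⟨x, y, r⟩, hr, rfl⟩ := h
  change a.left = y at hr
  subst hr
  exact ⟨r, rfl⟩

end Arrows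

/-! ### Infinite paths and the topology of cylinder sets -/

section Paths

variable {k : ℕ} {C : Type u} [SmallCategory C] {G : KGraph k C}

/-- The infinite path with prescribed initial segments. -/
theorem exists_infPath_seg (p : (Fin k → ℕ) → Arrow C) (hdeg : ∀ n, G.degree (p n) = n)
    (hp : ∀ m n, m ≤ n → IsPrefix (p m) (p n)) : ∃ x : G.InfPath, ∀ n, G.seg x n = p n := by
  -- `F m n` completes `p m` to `p n`; it will be the value of the path at the morphism (m, n). By
  -- left cancellation, the functor laws can be checked after multiplication by an initial segment.
  choose F hF using fun (m n : Fin k → ℕ) (h : m ≤ n) => (hp m n h).exists_hom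
  have uniq : ∀ (a : Arrow C) {z : C} (f g : z ⟶ a.left),
      mul a (Arrow.mk f) rfl = mul a (Arrow.mk g) rfl → f = g := fun a z f g h =>
    Arrow.mk_injective _ _ (mul_inj (G := G) h rfl).2
  have assoc : ∀ (u v w : Arrow C) (f : w.left ⟶ v.left) (g : v.left ⟶ u.left),
      mul u (Arrow.mk g) rfl = v → mul v (Arrow.mk f) rfl = w →
      mul u (Arrow.mk (f ≫ g)) rfl = w := by
    intro u v w f g e e'
    refine Eq.trans ?_ e'
    have h2 : ∀ (v' : Arrow C) (h : v'.left = v.left), v' = v →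
        mul v (Arrow.mk f) rfl = mul v' (Arrow.mk f) h := by rintro _ _ rfl; rfl
    rw [h2 (mul u (Arrow.mk g) rfl) rfl e, mul_assoc _ _ _ rfl rfl]
    refine congrArg (fun z => mul _ (Arrow.mk z) rfl) ?_
    exact congrArg (f ≫ ·) (Category.id_comp g).symm
  let x : G.InfPath :=
    { obj := fun n => (p n.coord).left
      map := fun {n m} f => F m.coord n.coord f.down
      map_id := fun n => by
        apply uniq
        rw [hF]
        exact (mul_vertex _ _ rfl).symm
      map_comp := fun {a b c} f g => by
        apply uniq
        rw [hF]
        exact (assoc _ _ _ _ _ (hF _ _ g.down) (hF _ _ f.down)).symm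
      deg_map := fun {n m} f => by
        have h := congrArg G.degree (hF _ _ f.down)
        rw [degree_mul, hdeg, hdeg] at h
        exact eq_tsub_of_add_eq ((add_comm _ _).trans h) }
  refine ⟨x, fun n => ?_⟩
  have h := hF 0 n (fun i => Nat.zero_le _)
  have h0 := eq_vertex_of_degree_eq_zero (hdeg 0)
  have key : ∀ (a r : Arrow C) (h : a.left = r.right), a = vertex a.left → mul a r h = r := by
    intro a r h e
    obtain ⟨v, rfl⟩ : ∃ v, a = vertex v := ⟨_, e⟩
    simp
  rw [key _ _ _ h0] at h
  exact h

@[simp] theorem degree_seg (x : G.InfPath) (n : Fin k → ℕ) : G.degree (G.seg x n) = n :=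
  (x.deg_map _).trans (funext fun i => Nat.sub_zero (n i))

/-- The shift `σ^n` on infinite paths. -/
def shift (n : Fin k → ℕ) (x : G.InfPath) : G.InfPath where
  obj a := x.obj ⟨n + a.coord⟩
  map {a b} h := x.map (X := ⟨n + a.coord⟩) (Y := ⟨n + b.coord⟩) ⟨add_le_add_right h.down n⟩
  map_id a := x.map_id ⟨n + a.coord⟩
  map_comp {a b c} f g := x.map_comp (X := ⟨n + a.coord⟩) (Y := ⟨n + b.coord⟩)
    (Z := ⟨n + c.coord⟩) ⟨add_le_add_right f.down n⟩ ⟨add_le_add_right g.down n⟩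
  deg_map {a b} _ := (x.deg_map _).trans (add_tsub_add_eq_tsub_left n a.coord b.coord)

theorem seg_add (x : G.InfPath) (n m : Fin k → ℕ) :
    G.seg x (n + m) = mul (G.seg x n) (G.seg (shift n x) m) rfl := by
  simp only [mul, seg, shift]
  refine congrArg Arrow.mk ?_
  simp only [Arrow.mk_left, Arrow.mk_right, Arrow.mk_hom]
  erw [Category.id_comp]
  exact x.map_comp (X := ⟨n + m⟩) (Y := ⟨n⟩) (Z := ⟨0⟩) ⟨le_self_add⟩ ⟨fun i => Nat.zero_le _⟩

theorem seg_isPrefix (x : G.InfPath) {m n : Fin k → ℕ} (h : m ≤ n) :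
    IsPrefix (G.seg x m) (G.seg x n) := by
  rw [← add_tsub_cancel_of_le h, seg_add]
  exact isPrefix_mul _ _ _

theorem mem_cyl {x : G.InfPath} {p : Arrow C} : x ∈ G.cyl p ↔ G.seg x (G.degree p) = p := Iff.rfl

theorem mem_cyl_seg (x : G.InfPath) (n : Fin k → ℕ) : x ∈ G.cyl (G.seg x n) := by
  rw [mem_cyl, degree_seg]

theorem mem_cyl_iff_isPrefix {x : G.InfPath} {p : Arrow C} {n : Fin k → ℕ} (h : G.degree p ≤ n) :
    x ∈ G.cyl p ↔ IsPrefix p (G.seg x n) := by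
  constructor
  · intro hx
    have := seg_isPrefix x h
    rwa [mem_cyl.1 hx] at this
  · intro hp
    exact (seg_isPrefix x h).eq_of_degree_eq hp (degree_seg x _)

theorem cyl_subset_of_isPrefix {p q : Arrow C} (h : IsPrefix p q) : G.cyl q ⊆ G.cyl p := by
  intro x hx
  rw [mem_cyl_iff_isPrefix (h.degree_le (G := G)), mem_cyl.1 hx]
  exact h

theorem isPrefix_of_mem_cyl {x : G.InfPath} {p q : Arrow C} (hp : x ∈ G.cyl p) (hq : x ∈ G.cyl q)
    (h : G.degree p ≤ G.degree q) : IsPrefix p q := by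
  have := seg_isPrefix x h
  rwa [mem_cyl.1 hp, mem_cyl.1 hq] at this

theorem eq_of_mem_cyl {x : G.InfPath} {p q : Arrow C} (hp : x ∈ G.cyl p) (hq : x ∈ G.cyl q)
    (h : G.degree p = G.degree q) : p = q := by
  rw [← mem_cyl.1 hp, h, mem_cyl.1 hq]

theorem disjoint_cyl {p q : Arrow C} (h : G.degree p = G.degree q) (hne : p ≠ q) :
    Disjoint (G.cyl p) (G.cyl q) :=
  Set.disjoint_left.2 fun _ hp hq => hne (eq_of_mem_cyl hp hq h)

theorem mem_cyl_mul {x : G.InfPath} {p q : Arrow C} (h : p.left = q.right) :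
    x ∈ G.cyl (mul p q h) ↔ x ∈ G.cyl p ∧ shift (G.degree p) x ∈ G.cyl q := by
  rw [mem_cyl, degree_mul, seg_add]
  constructor
  · intro e
    exact mul_inj e (degree_seg x _)
  · rintro ⟨h1, h2⟩
    rw [mem_cyl] at h1 h2
    congr 1

theorem shift_mem_cyl_right {x : G.InfPath} {p q : Arrow C} (hp : x ∈ G.cyl p)
    (hq : shift (G.degree p) x ∈ G.cyl q) : p.left = q.right := by
  have h1 := congrArg Arrow.left (mem_cyl.1 hp)
  have h2 := congrArg Arrow.right (mem_cyl.1 hq)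
  exact h1.symm.trans h2

/-- In x(0,n) = x(0,m) x(m,n) the last factor is recovered by left cancellation. -/
theorem ext_seg {x y : G.InfPath} (h : ∀ n, G.seg x n = G.seg y n) : x = y := by
  have hobj : ∀ n, x.obj n = y.obj n := fun n => congrArg Arrow.left (h n.coord)
  have hmap : ∀ {n m : Omega k} (f : n ⟶ m), Arrow.mk (x.map f) = Arrow.mk (y.map f) := by
    intro n m f
    have hx : ∀ z : G.InfPath, mul (G.seg z m.coord) (Arrow.mk (z.map f)) rfl
        = G.seg z n.coord := by
      intro z
      simp only [mul, seg]
      refine congrArg Arrow.mk ?_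
      simp only [Arrow.mk_left, Arrow.mk_right, Arrow.mk_hom]
      erw [Category.id_comp]
      exact (z.map_comp (X := n) (Y := m) (Z := ⟨0⟩) f ⟨fun i => Nat.zero_le _⟩).symm
    exact (mul_inj (G := G) ((hx x).trans ((h _).trans (hx y).symm))
      (by rw [degree_seg, degree_seg])).2
  have : x.toFunctor = y.toFunctor := by
    refine CategoryTheory.Functor.ext hobj fun n m f => ?_
    obtain ⟨_, _, e⟩ := (Arrow.mk_eq_mk_iff _ _).1 (hmap f)
    exact e
  cases x
  cases y
  congr

/-- The segment of degree n is cut from any member of `P` of large enough degree; common extensions,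
which need not belong to `P`, make the choices consistent. This yields both non-emptiness of
cylinders and compactness. -/
theorem exists_infPath_mem_cyl (P : Arrow C → Prop)
    (hdir : ∀ p q, P p → P q → ∃ r, IsPrefix p r ∧ IsPrefix q r)
    (hcof : ∀ n, ∃ p, P p ∧ n ≤ G.degree p) : ∃ x : G.InfPath, ∀ p, P p → x ∈ G.cyl p := by
  choose g hgP hg using hcof
  choose a ha hdeg using fun n => exists_isPrefix_degree (hg n)
  obtain ⟨x, hx⟩ := exists_infPath_seg (G := G) a hdeg fun m n h => by
    obtain ⟨r, h1, h2⟩ := hdir _ _ (hgP m) (hgP n)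
    refine ((ha m).trans h1).of_degree_le (G := G) ((ha n).trans h2) ?_
    rwa [hdeg, hdeg]
  refine ⟨x, fun p hp => ?_⟩
  rw [mem_cyl, hx]
  obtain ⟨r, h1, h2⟩ := hdir _ _ (hgP (G.degree p)) hp
  exact ((ha _).trans h1).eq_of_degree_eq h2 (hdeg _)

theorem cyl_nonempty (hsrc : G.HasNoSources) (p : Arrow C) : (G.cyl p).Nonempty := by
  choose e he hdeg using fun v => hsrc v 1
  -- Arrows of degree (1,…,1) are appended repeatedly, so that all coordinates of the degree grow.
  let γ : ℕ → Arrow C := fun n => Nat.rec p (fun _ q => mul q (e q.left) (he q.left).symm) n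
  have hγ : ∀ n, IsPrefix (γ n) (γ (n + 1)) := fun n => isPrefix_mul _ _ _
  have hmono : ∀ m n, m ≤ n → IsPrefix (γ m) (γ n) := by
    intro m n h
    induction n, h using Nat.le_induction with
    | base => exact IsPrefix.refl _
    | succ n _ ih => exact ih.trans (hγ n)
  have hd : ∀ n : ℕ, (fun _ => n) ≤ G.degree (γ n) := by
    intro n
    induction n with
    | zero => exact fun i => Nat.zero_le _
    | succ n ih =>
      intro i
      change n + 1 ≤ G.degree (mul (γ n) (e (γ n).left) _) i
      rw [degree_mul, hdeg]
      exact Nat.add_le_add_right (ih i) 1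
  obtain ⟨x, hx⟩ := exists_infPath_mem_cyl (G := G) (fun q => ∃ n, q = γ n)
    (by
      rintro _ _ ⟨m, rfl⟩ ⟨n, rfl⟩
      exact ⟨γ (max m n), hmono _ _ (le_max_left _ _), hmono _ _ (le_max_right _ _)⟩)
    (fun n => ⟨_, ⟨∑ i, n i, rfl⟩, fun i =>
      (Finset.single_le_sum (f := n) (fun _ _ => Nat.zero_le _) (Finset.mem_univ i)).trans
        (hd _ i)⟩)
  exact ⟨x, hx _ ⟨0, rfl⟩⟩

theorem isOpen_cyl (p : Arrow C) : IsOpen (G.cyl p) :=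
  TopologicalSpace.isOpen_generateFrom_of_mem (Set.mem_range_self p)

theorem isClosed_cyl (p : Arrow C) : IsClosed (G.cyl p) := by
  have : (G.cyl p)ᶜ = ⋃ q ∈ {q | G.degree q = G.degree p ∧ q ≠ p}, G.cyl q := by
    ext x
    simp only [Set.mem_compl_iff, Set.mem_iUnion, Set.mem_ofPred_eq, exists_prop]
    constructor
    · intro hx
      exact ⟨_, ⟨degree_seg x _, fun h => hx (mem_cyl.2 h)⟩, mem_cyl_seg x _⟩
    · rintro ⟨q, ⟨hq, hne⟩, hx⟩ hp
      exact hne (eq_of_mem_cyl hx hp hq)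
  rw [← isOpen_compl_iff, this]
  exact isOpen_biUnion fun q _ => isOpen_cyl q

theorem biUnion_cyl_eq_univ (n : Fin k → ℕ) : ⋃ p ∈ {p | G.degree p = n}, G.cyl p = Set.univ := by
  refine Set.eq_univ_of_forall fun x => ?_
  simp only [Set.mem_iUnion, exists_prop]
  exact ⟨_, degree_seg x n, mem_cyl_seg x n⟩

/-- For each n, an ultrafilter contains one of the finitely many cylinders of degree n, since these
cover the space. Any two cylinders in it meet, so their arrows have a common extension; the infinite
path they determine is a limit point. -/
theorem compactSpace (hfin : G.IsFinite) : CompactSpace G.InfPath := by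
  refine ⟨isCompact_iff_ultrafilter_le_nhds.2 fun F _ => ?_⟩
  obtain ⟨x, hx⟩ := exists_infPath_mem_cyl (G := G) (fun p => G.cyl p ∈ F)
    (fun p q hp hq => by
      obtain ⟨x, hxp, hxq⟩ := F.nonempty_of_mem (inter_mem hp hq)
      refine ⟨G.seg x (G.degree p ⊔ G.degree q), ?_, ?_⟩
      · exact (mem_cyl_iff_isPrefix le_sup_left).1 hxp
      · exact (mem_cyl_iff_isPrefix le_sup_right).1 hxq)
    (fun n => by
      have : (⋃ p ∈ {p | G.degree p = n}, G.cyl p) ∈ F := by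
        rw [biUnion_cyl_eq_univ]
        exact Filter.univ_mem
      obtain ⟨p, hp, h⟩ := (Ultrafilter.finite_biUnion_mem_iff (hfin n)).1 this
      exact ⟨p, h, le_of_eq hp.symm⟩)
  refine ⟨x, Set.mem_univ _, ?_⟩
  rw [TopologicalSpace.nhds_generateFrom]
  refine le_iInf₂ fun s hs => ?_
  obtain ⟨hxs, p, rfl⟩ := hs
  rw [le_principal_iff]
  by_contra hn
  have : (⋃ q ∈ {q | G.degree q = G.degree p}, G.cyl q) ∈ F := by
    rw [biUnion_cyl_eq_univ]
    exact Filter.univ_mem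
  obtain ⟨q, hq, h⟩ := (Ultrafilter.finite_biUnion_mem_iff (hfin _)).1 this
  exact hn (eq_of_mem_cyl (hx q h) hxs hq ▸ h)

end Paths

end

end KGraph

/-! ### Perron–Frobenius theory of nonnegative matrices -/

section PerronFrobenius

variable {n : Type*} [Fintype n]

theorem Matrix.mulVec_pos_of_pos {B : Matrix n n ℝ} (hB : ∀ i j, 0 < B i j) {y : n → ℝ}
    (hy : 0 ≤ y) (hy0 : y ≠ 0) (i : n) : 0 < B.mulVec y i := by
  obtain ⟨j, hj⟩ := Function.ne_iff.1 hy0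
  refine Finset.sum_pos' (fun l _ => mul_nonneg (hB i l).le (hy l)) ⟨j, Finset.mem_univ j, ?_⟩
  exact mul_pos (hB i j) ((hy j).lt_of_ne' hj)

/-- **Perron's theorem**: a positive matrix has a positive eigenvector. -/
theorem Matrix.exists_pos_eigenvector_of_pos [DecidableEq n] [Nonempty n] {B : Matrix n n ℝ}
    (hB : ∀ i j, 0 < B i j) :
    ∃ (r : ℝ) (x : n → ℝ), (∀ i, 0 < x i) ∧ ∑ i, x i = 1 ∧ B.mulVec x = r • x := by
  -- Collatz–Wielandt: t is maximized over pairs (t, y) with y in the simplex and t y ≤ B y. The sum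
  -- `R` of all entries bounds t and makes the set of pairs compact.
  set R : ℝ := ∑ i, ∑ j, B i j
  let S : Set (ℝ × (n → ℝ)) := (Set.Icc 0 R ×ˢ stdSimplex ℝ n) ∩
    {p | ∀ i, p.1 * p.2 i ≤ B.mulVec p.2 i}
  have hmem : ∀ (t : ℝ) (y : n → ℝ), 0 ≤ t → y ∈ stdSimplex ℝ n →
      (∀ i, t * y i ≤ B.mulVec y i) → (t, y) ∈ S := by
    intro t y ht hy h
    refine ⟨⟨⟨ht, ?_⟩, hy⟩, h⟩
    calc t = ∑ i, t * y i := by rw [← Finset.mul_sum, hy.2, mul_one]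
      _ ≤ ∑ i, B.mulVec y i := Finset.sum_le_sum fun i _ => h i
      _ ≤ R := by
        refine Finset.sum_le_sum fun i _ => Finset.sum_le_sum fun j _ => ?_
        have h1 : y j ≤ 1 := hy.2 ▸ Finset.single_le_sum (fun l _ => hy.1 l) (Finset.mem_univ j)
        exact mul_le_of_le_one_right (hB i j).le h1
  have hS : IsCompact S := by
    refine (isCompact_Icc.prod (isCompact_stdSimplex ℝ n)).inter_right ?_
    simp only [Set.ofPred_forall]
    refine isClosed_iInter fun i => isClosed_le (by fun_prop) ?_
    simp only [Matrix.mulVec, dotProduct]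
    fun_prop
  have hne : S.Nonempty := by
    obtain ⟨i⟩ := ‹Nonempty n›
    refine ⟨_, hmem 0 (Pi.single i 1) le_rfl (single_mem_stdSimplex ℝ i) fun j => ?_⟩
    rw [zero_mul]
    exact (Matrix.mulVec_pos_of_pos hB (by simp) (by simp) j).le
  obtain ⟨⟨r, x⟩, hrx, hmax⟩ := hS.exists_isMaxOn hne continuous_fst.continuousOn
  obtain ⟨⟨⟨hr, -⟩, hx0, hx1⟩, hle⟩ := hrx
  simp only at hr hx0 hx1 hle
  have hxne : x ≠ 0 := by
    rintro rfl
    simp at hx1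
  have hy := Matrix.mulVec_pos_of_pos hB hx0 hxne
  have heq : B.mulVec x = r • x := by
    -- If r x ≤ B x is not an equality, positivity of B makes B y > r y in every coordinate for y =
    -- B x. The least ratio `ε` can then be added to r, against maximality.
    by_contra hne
    set y := B.mulVec x
    have hz := Matrix.mulVec_pos_of_pos hB (y := y - r • x)
      (fun i => sub_nonneg.2 (hle i)) (sub_ne_zero.2 hne)
    rw [Matrix.mulVec_sub, Matrix.mulVec_smul] at hz
    obtain ⟨i, -, hi⟩ := Finset.exists_min_image Finset.univ
      (fun i => (B.mulVec y - r • y) i / y i) Finset.univ_nonempty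
    set ε := (B.mulVec y - r • y) i / y i
    have hε : 0 < ε := div_pos (hz i) (hy i)
    have hY : 0 < ∑ i, y i := Finset.sum_pos (fun i _ => hy i) Finset.univ_nonempty
    have hmem' := hmem (r + ε) ((∑ i, y i)⁻¹ • y) (by positivity)
      ⟨fun j => mul_nonneg (inv_nonneg.2 hY.le) (hy j).le, by
        simp only [Pi.smul_apply, smul_eq_mul]
        rw [← Finset.mul_sum, inv_mul_cancel₀ hY.ne']⟩ (fun j => by
        rw [Matrix.mulVec_smul]
        simp only [Pi.smul_apply, smul_eq_mul]
        rw [mul_left_comm]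
        refine mul_le_mul_of_nonneg_left ?_ (inv_nonneg.2 hY.le)
        have h := (le_div_iff₀ (hy j)).1 (hi j (Finset.mem_univ j))
        simp only [Pi.sub_apply, Pi.smul_apply, smul_eq_mul] at h
        linarith)
    have := hmax hmem'
    simp only [Set.mem_ofPred_eq] at this
    linarith
  refine ⟨r, x, fun i => ?_, hx1, heq⟩
  have := hy i
  rw [heq] at this
  exact pos_of_mul_pos_right this hr

/-- Uniqueness in the Perron-Frobenius theorem. -/
theorem Matrix.eigenvector_unique [DecidableEq n] [Nonempty n] {A : Matrix n n ℝ} (hA : ∀ i j, 0 ≤ A i j)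
    (hirr : ∀ i j, ∃ l : ℕ, 0 < (A ^ l) i j) {r : ℝ} {x y : n → ℝ} (hx : ∀ i, 0 < x i)
    (hAx : A.mulVec x = r • x) (hAy : A.mulVec y = r • y) : ∃ c : ℝ, y = c • x := by
  -- With c the least ratio, z = y - c x is nonnegative and vanishes at i. Row i of A^l z = r^l z is
  -- a vanishing sum of nonnegative terms, which forces z_j = 0 as soon as (A^l)_{ij} > 0.
  obtain ⟨i, -, hi⟩ := Finset.exists_min_image Finset.univ
    (fun i => y i / x i) Finset.univ_nonempty
  set c := y i / x i
  have hz : ∀ j, 0 ≤ (y - c • x) j := fun j => by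
    have := (le_div_iff₀ (hx j)).1 (hi j (Finset.mem_univ j))
    simpa using this
  have hzi : (y - c • x) i = 0 := by
    simp [c, (hx i).ne']
  have hpow : ∀ l : ℕ, (A ^ l).mulVec (y - c • x) = r ^ l • (y - c • x) := by
    intro l
    induction l with
    | zero => simp
    | succ l ih =>
      rw [pow_succ, ← Matrix.mulVec_mulVec, Matrix.mulVec_sub A, Matrix.mulVec_smul, hAx, hAy,
        smul_comm, ← smul_sub, Matrix.mulVec_smul, ih, smul_smul, pow_succ']
  have hnn : ∀ (l : ℕ) (i j : n), 0 ≤ (A ^ l) i j := by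
    intro l
    induction l with
    | zero =>
      intro i j
      rw [pow_zero, Matrix.one_apply]
      split_ifs <;> norm_num
    | succ l ih =>
      intro i j
      rw [pow_succ, Matrix.mul_apply]
      exact Finset.sum_nonneg fun m _ => mul_nonneg (ih i m) (hA m j)
  refine ⟨c, sub_eq_zero.1 (funext fun j => ?_)⟩
  obtain ⟨l, hl⟩ := hirr i j
  have h0 : ∑ m, (A ^ l) i m * (y - c • x) m = 0 := by
    have := congrFun (hpow l) i
    rw [Pi.smul_apply, hzi, smul_zero] at this
    exact this
  have := (Finset.sum_eq_zero_iff_of_nonneg fun m _ => mul_nonneg (hnn l i m) (hz m)).1 h0 j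
    (Finset.mem_univ j)
  exact (mul_eq_zero.1 this).resolve_left hl.ne'

/-- The spectral radius of a nonnegative matrix with a positive eigenvector. -/
theorem Matrix.spectralRadius_eq_of_pos_eigenvector [DecidableEq n] [Nonempty n] {A : Matrix n n ℕ} {r : ℝ}
    {x : n → ℝ} (hx : ∀ i, 0 < x i)
    (hAx : (A.map (Nat.cast : ℕ → ℝ)).mulVec x = r • x) :
    spectralRadius ℂ (A.map (Nat.cast : ℕ → ℂ)) = ENNReal.ofReal r := by
  have hspec : ∀ μ : ℂ, μ ∈ spectrum ℂ (A.map (Nat.cast : ℕ → ℂ)) ↔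
      ∃ v ≠ 0, (A.map (Nat.cast : ℕ → ℂ)).mulVec v = μ • v := by
    intro μ
    rw [spectrum.mem_iff, Matrix.isUnit_iff_isUnit_det, isUnit_iff_ne_zero, not_not,
      ← Matrix.exists_mulVec_eq_zero_iff]
    refine exists_congr fun v => and_congr_right fun _ => ?_
    rw [Matrix.sub_mulVec, sub_eq_zero, Algebra.algebraMap_eq_smul_one, Matrix.smul_mulVec,
      Matrix.one_mulVec, eq_comm]
  have hr : 0 ≤ r := by
    obtain ⟨i⟩ := ‹Nonempty n›
    have h1 : 0 ≤ (A.map (Nat.cast : ℕ → ℝ)).mulVec x i :=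
      Finset.sum_nonneg fun j _ => mul_nonneg (Nat.cast_nonneg _) (hx j).le
    rw [hAx] at h1
    exact nonneg_of_mul_nonneg_left h1 (hx i)
  apply le_antisymm
  · refine iSup₂_le fun μ hμ => ?_
    obtain ⟨v, hv, h⟩ := (hspec μ).1 hμ
    -- In the weighted norm max_i |v_i| / x_i the matrix A has norm at most r; the eigenvalue
    -- equation is read at an index attaining the maximum.
    obtain ⟨i, -, hi⟩ := Finset.exists_max_image Finset.univ
      (fun i => ‖v i‖ / x i) Finset.univ_nonempty
    set c := ‖v i‖ / x i
    have hle : ∀ j, ‖v j‖ ≤ c * x j := fun j =>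
      (div_le_iff₀ (hx j)).1 (hi j (Finset.mem_univ j))
    have hvi : ‖v i‖ = c * x i := (div_mul_cancel₀ _ (hx i).ne').symm
    have hc : 0 < c := by
      obtain ⟨j, hj⟩ := Function.ne_iff.1 hv
      have : 0 < c * x j := (norm_pos_iff.2 hj).trans_le (hle j)
      exact pos_of_mul_pos_left this (hx j).le
    have key : ‖μ‖ * (c * x i) ≤ r * (c * x i) := by
      calc ‖μ‖ * (c * x i) = ‖(μ • v) i‖ := by rw [← hvi, Pi.smul_apply, norm_smul]
        _ = ‖∑ j, (A i j : ℂ) * v j‖ := by rw [← h]; rfl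
        _ ≤ ∑ j, ‖(A i j : ℂ) * v j‖ := norm_sum_le _ _
        _ ≤ ∑ j, c * ((A i j : ℝ) * x j) := by
          refine Finset.sum_le_sum fun j _ => ?_
          rw [norm_mul, Complex.norm_natCast, mul_left_comm]
          exact mul_le_mul_of_nonneg_left (hle j) (Nat.cast_nonneg _)
        _ = c * (r • x) i := by rw [← Finset.mul_sum, ← hAx]; rfl
        _ = r * (c * x i) := by rw [Pi.smul_apply, smul_eq_mul]; ring
    have hμr : ‖μ‖ ≤ r := le_of_mul_le_mul_right key (mul_pos hc (hx i))
    rw [← enorm_eq_nnnorm, ← ofReal_norm]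
    exact ENNReal.ofReal_le_ofReal hμr
  · have hmem : (r : ℂ) ∈ spectrum ℂ (A.map (Nat.cast : ℕ → ℂ)) := by
      refine (hspec _).2 ⟨fun i => (x i : ℂ), ?_, funext fun i => ?_⟩
      · obtain ⟨i⟩ := ‹Nonempty n›
        exact fun h => (hx i).ne' (by simpa using congrFun h i)
      · have := congrArg (fun t : ℝ => (t : ℂ)) (congrFun hAx i)
        simpa [Matrix.mulVec, dotProduct] using this
    refine le_trans (le_of_eq ?_) (le_iSup₂ (f := fun (μ : ℂ) _ => (‖μ‖₊ : ℝ≥0∞)) _ hmem)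
    rw [← enorm_eq_nnnorm, ← ofReal_norm, Complex.norm_real, Real.norm_of_nonneg hr]

end PerronFrobenius

/-! ### Adjacency matrices and their common eigenvector -/

namespace KGraph

noncomputable section

section Adjacency

variable {k : ℕ} {C : Type u} [SmallCategory C] (G : KGraph k C)

/-- The number of arrows of degree `n` from `w` to `v`. -/
def adjDeg (n : Fin k → ℕ) : Matrix C C ℕ := fun v w => Nat.card {f : w ⟶ v // G.deg f = n}

/-- The set `v Λ^n` of arrows of degree `n` with range `v`. -/
def PathsTo (v : C) (n : Fin k → ℕ) : Type u := {p : Arrow C // p.right = v ∧ G.degree p = n}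

variable {G}

theorem IsFinite.finite_pathsTo (hfin : G.IsFinite) (v : C) (n : Fin k → ℕ) :
    Finite (G.PathsTo v n) :=
  ((hfin n).subset fun _ h => h.2).to_subtype

theorem IsFinite.finite_hom (hfin : G.IsFinite) (v w : C) (n : Fin k → ℕ) :
    Finite {f : w ⟶ v // G.deg f = n} := by
  have := hfin.finite_pathsTo v n
  refine Finite.of_injective (β := G.PathsTo v n)
    (fun f => ⟨Arrow.mk f.1, rfl, f.2⟩) fun f g h => ?_
  exact Subtype.ext (Arrow.mk_injective _ _ (congrArg Subtype.val h))

/-- An arrow of degree `n` into `v` is a vertex `w` with an arrow of degree `n` from `w` to `v`. -/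
def pathsToEquiv (v : C) (n : Fin k → ℕ) :
    (Σ w : C, {f : w ⟶ v // G.deg f = n}) ≃ G.PathsTo v n where
  toFun f := ⟨Arrow.mk f.2.1, rfl, f.2.2⟩
  invFun p := ⟨p.1.left, p.1.hom ≫ eqToHom p.2.1, by
    obtain ⟨⟨a, b, f⟩, rfl, h⟩ := p
    exact (congrArg G.deg (Category.comp_id f)).trans h⟩
  left_inv := by
    rintro ⟨w, f, hf⟩
    simp
  right_inv := by
    rintro ⟨⟨a, b, f⟩, rfl, h⟩
    refine Subtype.ext ?_
    exact congrArg Arrow.mk (Category.comp_id f)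

theorem adjDeg_zero [DecidableEq C] : G.adjDeg 0 = 1 := by
  ext v w
  rw [Matrix.one_apply, adjDeg]
  have key : ∀ f : w ⟶ v, G.deg f = 0 → Arrow.mk f = vertex w := fun f hf =>
    eq_vertex_of_degree_eq_zero (G := G) (p := Arrow.mk f) hf
  split_ifs with h
  · subst h
    rw [Nat.card_eq_one_iff_exists]
    refine ⟨⟨𝟙 v, G.deg_id v⟩, fun f => Subtype.ext ?_⟩
    exact Arrow.mk_injective _ _ (key f.1 f.2)
  · have : IsEmpty {f : w ⟶ v // G.deg f = 0} :=
      ⟨fun f => h (congrArg Arrow.right (key f.1 f.2))⟩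
    exact Nat.card_of_isEmpty

variable [Fintype C]

theorem sum_pathsTo {R : Type*} [CommSemiring R] (hfin : G.IsFinite) (v : C) (n : Fin k → ℕ)
    [Fintype (G.PathsTo v n)] (F : C → R) :
    ∑ p : G.PathsTo v n, F p.1.left = ∑ w, (G.adjDeg n v w : R) * F w := by
  have := fun w => hfin.finite_hom v w n
  have := fun w => Fintype.ofFinite {f : w ⟶ v // G.deg f = n}
  rw [← (pathsToEquiv v n).sum_comp, Fintype.sum_sigma]
  refine Finset.sum_congr rfl fun w _ => ?_
  rw [adjDeg, Nat.card_eq_fintype_card, ← nsmul_eq_mul]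
  exact Finset.sum_const (F w)

/-- Unique factorization makes composition a bijection from composable pairs of degrees m and n onto
the arrows of degree m + n. Commutativity of the adjacency matrices follows. -/
theorem adjDeg_add (hfin : G.IsFinite) (m n : Fin k → ℕ) :
    G.adjDeg (m + n) = G.adjDeg m * G.adjDeg n := by
  ext v w
  have := fun u => hfin.finite_hom v u m
  have := fun u => hfin.finite_hom u w n
  rw [Matrix.mul_apply]
  simp only [adjDeg]
  simp only [← Nat.card_prod]
  rw [← Nat.card_sigma]
  symm
  refine Nat.card_congr (Equiv.ofBijective
    (fun p => ⟨p.2.2.1 ≫ p.2.1.1, by rw [G.deg_comp, p.2.1.2, p.2.2.2]⟩) ⟨?_, ?_⟩)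
  · rintro ⟨u, ⟨g, hg⟩, ⟨h, hh⟩⟩ ⟨u', ⟨g', hg'⟩, ⟨h', hh'⟩⟩ e
    have e' : h ≫ g = h' ≫ g' := congrArg Subtype.val e
    have := (G.factorization (h ≫ g) m n (by rw [G.deg_comp, hg, hh])).unique
      (y₁ := ⟨u, h, g⟩) (y₂ := ⟨u', h', g'⟩) ⟨hg, hh, rfl⟩ ⟨hg', hh', e'.symm⟩
    cases this
    rfl
  · rintro ⟨f, hf⟩
    obtain ⟨⟨u, h, g⟩, ⟨h1, h2, h3⟩, -⟩ := G.factorization f m n hf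
    exact ⟨⟨u, ⟨g, h1⟩, ⟨h, h2⟩⟩, Subtype.ext h3⟩

/-- `adjDeg` is a monoid homomorphism on ℕ^k, and the generators sum to (1,…,1). This rewrites the
matrix in the irreducibility hypothesis. -/
theorem prod_ofFn_adj [DecidableEq C] (hfin : G.IsFinite) :
    (List.ofFn G.adj).prod = G.adjDeg 1 := by
  let φ : Multiplicative (Fin k → ℕ) →* Matrix C C ℕ :=
    { toFun := fun n => G.adjDeg n.toAdd
      map_one' := adjDeg_zero
      map_mul' := fun m n => adjDeg_add hfin m.toAdd n.toAdd }
  have h := map_list_prod φ (List.ofFn fun i : Fin k => Multiplicative.ofAdd (Pi.single i 1))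
  rw [List.map_ofFn, List.prod_ofFn] at h
  refine h.symm.trans ?_
  change G.adjDeg (Multiplicative.toAdd _) = _
  congr 1
  rw [toAdd_prod]
  simp only [toAdd_ofAdd]
  exact Finset.univ_sum_single (1 : Fin k → ℕ)

theorem adjDeg_commute (hfin : G.IsFinite) (m n : Fin k → ℕ) :
    G.adjDeg m * G.adjDeg n = G.adjDeg n * G.adjDeg m := by
  rw [← adjDeg_add hfin, add_comm, adjDeg_add hfin]

/-- A single A_i need not be irreducible. Strong connectivity makes `D`, a sum over one connecting
arrow for each pair of vertices, entrywise positive. Each A_i commutes with `D`, so it maps the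
Perron vector x of `D` to a multiple of x, and positivity of x identifies the factor as the spectral
radius. -/
theorem exists_isPerronFrobenius [DecidableEq C] [Nonempty C] (hfin : G.IsFinite)
    (hconn : G.IsStronglyConnected) : ∃ x, G.IsPerronFrobenius x := by
  let f := fun v w => (hconn v w).some
  let D : Matrix C C ℕ := ∑ p : C × C, G.adjDeg (G.deg (f p.1 p.2))
  have hD : ∀ v w, 0 < D v w := by
    intro v w
    simp only [D, Matrix.sum_apply]
    refine Finset.sum_pos' (fun _ _ => Nat.zero_le _) ⟨(v, w), Finset.mem_univ _, ?_⟩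
    have := hfin.finite_hom v w (G.deg (f v w))
    exact Nat.card_pos_iff.2 ⟨⟨⟨_, rfl⟩⟩, this⟩
  let B : Matrix C C ℝ := D.map (Nat.cast : ℕ → ℝ)
  have hB : ∀ v w, 0 < B v w := fun v w => Nat.cast_pos.2 (hD v w)
  obtain ⟨r, x, hx, hx1, hBx⟩ := Matrix.exists_pos_eigenvector_of_pos hB
  refine ⟨x, hx, hx1, fun i => ?_⟩
  set A : Matrix C C ℝ := (G.adj i).map (Nat.cast : ℕ → ℝ)
  have hcomm : A * B = B * A := by
    have h : G.adj i * D = D * G.adj i := by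
      rw [Finset.mul_sum, Finset.sum_mul]
      exact Finset.sum_congr rfl fun p _ => adjDeg_commute hfin _ _
    have := congrArg (fun M => M.map (Nat.castRingHom ℝ)) h
    rw [Matrix.map_mul, Matrix.map_mul] at this
    exact this
  obtain ⟨c, hc⟩ := Matrix.eigenvector_unique (fun i j => (hB i j).le)
    (fun i j => ⟨1, by simpa using hB i j⟩) hx hBx (y := A.mulVec x) (by
      rw [Matrix.mulVec_mulVec, ← hcomm, ← Matrix.mulVec_mulVec, hBx, Matrix.mulVec_smul])
  have hc0 : 0 ≤ c := by
    obtain ⟨v⟩ := ‹Nonempty C›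
    have h1 : 0 ≤ A.mulVec x v :=
      Finset.sum_nonneg fun j _ => mul_nonneg (Nat.cast_nonneg _) (hx j).le
    rw [hc] at h1
    exact nonneg_of_mul_nonneg_left h1 (hx v)
  rw [hc, rho, Matrix.spectralRadius_eq_of_pos_eigenvector hx hc, ENNReal.toReal_ofReal hc0]

end Adjacency

section Eigenvector

variable {k : ℕ} {C : Type u} [SmallCategory C] [Fintype C] [DecidableEq C] {G : KGraph k C}

theorem isPerronFrobenius_pfVector [Nonempty C] (hfin : G.IsFinite)
    (hconn : G.IsStronglyConnected) : G.IsPerronFrobenius G.pfVector := by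
  have h := exists_isPerronFrobenius hfin hconn
  rw [pfVector, dif_pos h]
  exact h.choose_spec

theorem rhoPow_add (m n : Fin k → ℕ) : G.rhoPow (m + n) = G.rhoPow m * G.rhoPow n := by
  simp only [rhoPow, Pi.add_apply, pow_add, Finset.prod_mul_distrib]

@[simp] theorem rhoPow_zero : G.rhoPow 0 = 1 := by simp [rhoPow]

@[simp] theorem rhoPow_single (i : Fin k) : G.rhoPow (Pi.single i 1) = G.rho i := by
  rw [rhoPow, Finset.prod_eq_single i] <;> simp +contextual

theorem adjDeg_mulVec_pfVector (hfin : G.IsFinite) (hpf : G.IsPerronFrobenius G.pfVector)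
    (n : Fin k → ℕ) :
    ((G.adjDeg n).map (Nat.cast : ℕ → ℝ)).mulVec G.pfVector = G.rhoPow n • G.pfVector := by
  let H : AddSubmonoid (Fin k → ℕ) :=
    { carrier := {n | ((G.adjDeg n).map (Nat.cast : ℕ → ℝ)).mulVec G.pfVector
        = G.rhoPow n • G.pfVector}
      zero_mem' := by
        change ((G.adjDeg 0).map (Nat.cast : ℕ → ℝ)).mulVec _ = _
        simp [adjDeg_zero]
      add_mem' := by
        intro m n hm hn
        change ((G.adjDeg (m + n)).map (Nat.castRingHom ℝ)).mulVec _ = _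
        change ((G.adjDeg m).map (Nat.castRingHom ℝ)).mulVec _ = _ at hm
        change ((G.adjDeg n).map (Nat.castRingHom ℝ)).mulVec _ = _ at hn
        rw [adjDeg_add hfin, Matrix.map_mul, ← Matrix.mulVec_mulVec, hn, Matrix.mulVec_smul, hm,
          smul_smul, rhoPow_add, mul_comm] }
  have hsingle : ∀ i : Fin k, (Pi.single i 1 : Fin k → ℕ) ∈ H := fun i => by
    refine (hpf.2.2 i).trans ?_
    rw [rhoPow_single]
  have : n = ∑ i, n i • (Pi.single i 1 : Fin k → ℕ) := by
    conv_lhs => rw [← Finset.univ_sum_single n]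
    refine Finset.sum_congr rfl fun i _ => ?_
    rw [← Pi.single_smul]
    simp
  change n ∈ H
  rw [this]
  exact H.sum_mem fun i _ => H.nsmul_mem (hsingle i) _

theorem sum_pfVector (hfin : G.IsFinite) (hpf : G.IsPerronFrobenius G.pfVector) (v : C)
    (n : Fin k → ℕ) [Fintype (G.PathsTo v n)] :
    ∑ p : G.PathsTo v n, G.pfVector p.1.left = G.rhoPow n * G.pfVector v := by
  rw [sum_pathsTo hfin]
  exact congrFun (adjDeg_mulVec_pfVector hfin hpf n) v

/-- At a vertex v where x^Λ is minimal, a single edge of color i with range v already contributes at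
least x_v to (A_i x)_v = ρ_i x_v. -/
theorem one_le_rho [Nonempty C] (hfin : G.IsFinite) (hsrc : G.HasNoSources)
    (hpf : G.IsPerronFrobenius G.pfVector) (i : Fin k) : 1 ≤ G.rho i := by
  obtain ⟨v, -, hv⟩ := Finset.exists_min_image Finset.univ G.pfVector Finset.univ_nonempty
  have := hfin.finite_pathsTo v (Pi.single i 1)
  have := Fintype.ofFinite (G.PathsTo v (Pi.single i 1))
  have h := sum_pfVector hfin hpf v (Pi.single i 1)
  rw [rhoPow_single] at h
  obtain ⟨p, hp, hd⟩ := hsrc v (Pi.single i 1)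
  have h1 : G.pfVector p.left ≤ G.rho i * G.pfVector v := h ▸
    Finset.single_le_sum (f := fun p : G.PathsTo v (Pi.single i 1) => G.pfVector p.1.left)
      (fun p _ => (hpf.1 _).le) (Finset.mem_univ ⟨p, hp, hd⟩)
  have h2 := hv p.left (Finset.mem_univ _)
  have h3 : 1 * G.pfVector v ≤ G.rho i * G.pfVector v := by linarith
  exact le_of_mul_le_mul_right h3 (hpf.1 v)

theorem one_le_rhoPow [Nonempty C] (hfin : G.IsFinite) (hsrc : G.HasNoSources)
    (hpf : G.IsPerronFrobenius G.pfVector) (n : Fin k → ℕ) : 1 ≤ G.rhoPow n := by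
  rw [rhoPow]
  exact Finset.prod_induction _ (fun t : ℝ => 1 ≤ t) (fun _ _ => one_le_mul_of_one_le_of_one_le)
    le_rfl fun i _ => one_le_pow₀ (one_le_rho hfin hsrc hpf i)

theorem pfVector_le_one (hpf : G.IsPerronFrobenius G.pfVector) (v : C) : G.pfVector v ≤ 1 :=
  hpf.2.1 ▸ Finset.single_le_sum (fun w _ => (hpf.1 w).le) (Finset.mem_univ v)

end Eigenvector

end

end KGraph

/-! ### Limits of measures on clopen sets -/

theorem MeasureTheory.isSetRing_isClopen (X : Type*) [TopologicalSpace X] :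
    IsSetRing {s : Set X | IsClopen s} where
  empty_mem := isClopen_empty
  union_mem _ _ hs ht := hs.union ht
  sdiff_mem _ _ hs ht := hs.diff ht

/-- On a compact space whose Borel sets are generated by the clopen sets, each sequence of measures
has a limit measure, in the sense of convergence on clopen sets. -/
theorem MeasureTheory.exists_measure_isClopen_eq {X : Type*} [TopologicalSpace X] [CompactSpace X]
    [MeasurableSpace X]
    (hgen : ‹MeasurableSpace X› = MeasurableSpace.generateFrom {s : Set X | IsClopen s})
    (ν : ℕ → Measure X) :
    ∃ μ : Measure X, ∀ A, IsClopen A → ∀ L, Tendsto (fun N => ν N A) atTop (𝓝 L) → μ A = L := by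
  -- Along a fixed ultrafilter every sequence in the compact space [0,∞] converges, and finite
  -- additivity passes to the limit.
  let F : Ultrafilter ℕ := hyperfilter ℕ
  have hlim : ∀ A : Set X, ∃ L, Tendsto (fun N => ν N A) F (𝓝 L) := fun A =>
    ⟨_, Ultrafilter.le_nhds_lim (F.map fun N => ν N A)⟩
  choose m hm using hlim
  have hR := isSetRing_isClopen X
  let c : AddContent ℝ≥0∞ {s : Set X | IsClopen s} := hR.addContent_of_union m
    (tendsto_nhds_unique (hm ∅) (by simp)) (fun {s t} _ ht hd => by
      refine tendsto_nhds_unique (hm (s ∪ t)) (((hm s).add (hm t)).congr fun N => ?_)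
      have htm : MeasurableSet t := by
        rw [hgen]
        exact MeasurableSpace.measurableSet_generateFrom ht
      exact (measure_union hd htm).symm)
  have hc : c.IsSigmaSubadditive := by
    intro f hf hU
    -- A countable union of clopen sets that is itself clopen is compact, hence a finite union. So
    -- countable subadditivity comes from finite subadditivity.
    obtain ⟨t, ht⟩ := hU.isClosed.isCompact.elim_finite_subcover f (fun i => (hf i).isOpen) le_rfl
    calc c (⋃ i, f i) ≤ c (⋃ i ∈ t, f i) :=
          addContent_mono hR.isSetSemiring hU (hR.biUnion_mem t fun i _ => hf i) ht
      _ ≤ ∑ i ∈ t, c (f i) := addContent_biUnion_le hR fun i _ => hf i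
      _ ≤ ∑' i, c (f i) := ENNReal.sum_le_tsum t
  refine ⟨c.measure hR.isSetSemiring hgen.le hc, fun A hA L hL => ?_⟩
  rw [c.measure_eq hR.isSetSemiring hgen hc hA]
  exact tendsto_nhds_unique (hm A) (hL.mono_left Nat.hyperfilter_le_atTop)

/-! ### Degrees of paths in the Bratteli diagram -/

namespace KGraph

noncomputable section

section Rainbow

variable {k : ℕ} [NeZero k]

/-- The case j = k is included; it agrees with q + 1 and j = 0, and it covers the last color of a
period. -/
theorem rainbow_mul_add (q : ℕ) {j : ℕ} (hj : j ≤ k) (i : Fin k) :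
    rainbow k (q * k + j) i = q + if (i : ℕ) < j then 1 else 0 := by
  have hk : 0 < k := Nat.pos_of_ne_zero (NeZero.ne k)
  rcases hj.lt_or_eq with h | rfl
  · rw [rainbow, Nat.mul_add_mod', Nat.mod_eq_of_lt h, Nat.mul_comm q k, Nat.mul_add_div hk,
      Nat.div_eq_of_lt h, add_zero]
  · have h1 : q * j + j = (q + 1) * j := by ring
    simp [rainbow, h1, Nat.mul_div_cancel _ hk, i.2]

theorem rainbow_mul (q : ℕ) : rainbow k (q * k) = fun _ => q := by
  funext i
  simpa using rainbow_mul_add (k := k) q (Nat.zero_le k) i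

theorem rainbow_zero : rainbow k 0 = 0 := by
  simpa using! rainbow_mul (k := k) 0

theorem rainbow_mul_add_eq (q : ℕ) (j : Fin k) :
    rainbow k (q * k + j) = (fun _ => q) + initDeg j :=
  funext fun i => rainbow_mul_add q j.2.le i

theorem rainbow_succ (n : ℕ) :
    rainbow k (n + 1) = rainbow k n + Pi.single (Fin.ofNat k n) 1 := by
  have hk : 0 < k := Nat.pos_of_ne_zero (NeZero.ne k)
  have hn := Nat.div_add_mod' n k
  have hlt := Nat.mod_lt n hk
  funext i
  conv_lhs => rw [← hn, add_assoc, rainbow_mul_add _ hlt]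
  rw [Pi.add_apply, Pi.single_apply, rainbow]
  simp only [Fin.ext_iff, Fin.val_ofNat]
  split_ifs <;> omega

theorem rainbow_mono : Monotone (rainbow k) :=
  monotone_nat_of_le_succ fun n => by
    rw [rainbow_succ]
    exact le_self_add

theorem sum_rainbow (n : ℕ) : ∑ i, rainbow k n i = n := by
  induction n with
  | zero => simp [rainbow_zero]
  | succ n ih => simp [rainbow_succ, Finset.sum_add_distrib, ih]

end Rainbow

/-! ### Cylinder sets as a generating π-system -/

section Cylinders

variable {k : ℕ} {C : Type u} [SmallCategory C] {G : KGraph k C}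

theorem cyl_eq_iUnion (p : Arrow C) (n : Fin k → ℕ) :
    G.cyl p = ⋃ r : G.PathsTo p.left n, G.cyl (mul p r.1 r.2.1.symm) := by
  ext x
  simp only [Set.mem_iUnion]
  constructor
  · intro hx
    have h := mem_cyl_seg (shift (G.degree p) x) n
    exact ⟨⟨_, (shift_mem_cyl_right hx h).symm, degree_seg _ _⟩, (mem_cyl_mul _).2 ⟨hx, h⟩⟩
  · rintro ⟨r, hr⟩
    exact ((mem_cyl_mul _).1 hr).1

theorem mul_pathsTo_injective (p : Arrow C) (n : Fin k → ℕ) :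
    Function.Injective fun r : G.PathsTo p.left n => mul p r.1 r.2.1.symm :=
  fun _ _ h => Subtype.ext (mul_inj (G := G) h rfl).2

theorem pairwise_disjoint_cyl_mul (p : Arrow C) (n : Fin k → ℕ) :
    Pairwise (Function.onFun Disjoint
      fun r : G.PathsTo p.left n => G.cyl (mul p r.1 r.2.1.symm)) := by
  intro r s hrs
  refine disjoint_cyl ?_ ((mul_pathsTo_injective p n).ne hrs)
  rw [degree_mul, degree_mul, r.2.2, s.2.2]

theorem iUnion_cyl_vertex : ⋃ v : C, G.cyl (vertex v) = Set.univ := by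
  refine Set.eq_univ_of_forall fun x => Set.mem_iUnion.2 ⟨(G.seg x 0).left, ?_⟩
  have h := eq_vertex_of_degree_eq_zero (degree_seg x 0)
  rw [← h]
  exact mem_cyl_seg x 0

theorem pairwise_disjoint_cyl_vertex :
    Pairwise (Function.onFun Disjoint fun v : C => G.cyl (vertex v)) := by
  intro v w h
  refine disjoint_cyl (by simp) fun e => h (congrArg Arrow.left e)

theorem measure_univ_eq_sum [Fintype C] (μ : Measure G.InfPath) :
    μ Set.univ = ∑ v, μ (G.cyl (vertex v)) := by
  rw [← iUnion_cyl_vertex, measure_iUnion pairwise_disjoint_cyl_vertex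
    fun _ => G.measurableSet_cyl _, tsum_fintype]

theorem secondCountableTopology (G : KGraph k C) : SecondCountableTopology G.InfPath :=
  have := G.countable_arrows
  ⟨⟨_, Set.countable_range G.cyl, rfl⟩⟩

theorem measurableSpace_eq_generateFrom_range (G : KGraph k C) :
    (inferInstance : MeasurableSpace G.InfPath)
      = MeasurableSpace.generateFrom (Set.range G.cyl) := by
  have := G.secondCountableTopology
  exact borel_eq_generateFrom_of_subbasis rfl

theorem measurableSpace_eq_generateFrom_isClopen (G : KGraph k C) :
    (inferInstance : MeasurableSpace G.InfPath)
      = MeasurableSpace.generateFrom {s : Set G.InfPath | IsClopen s} := by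
  apply le_antisymm
  · rw [measurableSpace_eq_generateFrom_range]
    refine MeasurableSpace.generateFrom_mono ?_
    rintro _ ⟨p, rfl⟩
    exact ⟨isClosed_cyl p, isOpen_cyl p⟩
  · exact MeasurableSpace.generateFrom_le fun s hs => hs.isOpen.measurableSet

section Rainbow

variable [NeZero k]

/-- The cylinder sets of the finite paths in the Bratteli diagram. -/
def rainbowCyl (G : KGraph k C) : Set (Set G.InfPath) := G.cyl '' {p | G.IsRainbow p}

theorem isRainbow_of_degree_eq {p : Arrow C} {n : ℕ} (h : G.degree p = rainbow k n) :
    G.IsRainbow p := by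
  rw [IsRainbow, length, h, sum_rainbow]

theorem length_of_degree_eq {p : Arrow C} {n : ℕ} (h : G.degree p = rainbow k n) :
    G.length p = n := by
  rw [length, h, sum_rainbow]

theorem isRainbow_vertex (v : C) : G.IsRainbow (vertex v) :=
  isRainbow_of_degree_eq (n := 0) (by rw [degree_vertex, rainbow_zero])

/-- The degrees `rainbow k n` are totally ordered, unlike general degrees in ℕ^k. So the cylinders
of Bratteli paths are nested or disjoint, which makes them a π-system. -/
theorem IsRainbow.isPrefix_or {p q : Arrow C} (hp : G.IsRainbow p) (hq : G.IsRainbow q)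
    {x : G.InfPath} (hxp : x ∈ G.cyl p) (hxq : x ∈ G.cyl q) : IsPrefix p q ∨ IsPrefix q p := by
  rcases le_total (G.length p) (G.length q) with h | h
  · refine Or.inl (isPrefix_of_mem_cyl hxp hxq ?_)
    rw [hp, hq]
    exact rainbow_mono h
  · refine Or.inr (isPrefix_of_mem_cyl hxq hxp ?_)
    rw [hp, hq]
    exact rainbow_mono h

theorem isPiSystem_rainbowCyl (G : KGraph k C) : IsPiSystem G.rainbowCyl := by
  rintro _ ⟨p, hp, rfl⟩ _ ⟨q, hq, rfl⟩ ⟨x, hxp, hxq⟩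
  rcases IsRainbow.isPrefix_or hp hq hxp hxq with h | h
  · rw [Set.inter_eq_right.2 (cyl_subset_of_isPrefix h)]
    exact ⟨q, hq, rfl⟩
  · rw [Set.inter_eq_left.2 (cyl_subset_of_isPrefix h)]
    exact ⟨p, hp, rfl⟩

theorem le_rainbow_sum_mul (n : Fin k → ℕ) : n ≤ rainbow k ((∑ i, n i) * k) := fun i => by
  rw [rainbow_mul]
  exact Finset.single_le_sum (f := n) (fun _ _ => Nat.zero_le _) (Finset.mem_univ i)

/-- With N the sum of the coordinates of d(p), the cylinder [p] splits into countably many cylinders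
of degree (N,…,N), the degree of Bratteli paths of length N k. -/
theorem measurableSpace_eq_generateFrom_rainbowCyl (G : KGraph k C) :
    (inferInstance : MeasurableSpace G.InfPath)
      = MeasurableSpace.generateFrom G.rainbowCyl := by
  have := G.countable_arrows
  apply le_antisymm
  · rw [measurableSpace_eq_generateFrom_range]
    refine MeasurableSpace.generateFrom_le ?_
    rintro _ ⟨p, rfl⟩
    have hle := le_rainbow_sum_mul (G.degree p)
    rw [cyl_eq_iUnion p (rainbow k ((∑ i, G.degree p i) * k) - G.degree p)]
    have : Countable (G.PathsTo p.left (rainbow k ((∑ i, G.degree p i) * k) - G.degree p)) :=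
      inferInstanceAs (Countable (Subtype _))
    refine MeasurableSet.iUnion fun r => MeasurableSpace.measurableSet_generateFrom ⟨_, ?_, rfl⟩
    refine isRainbow_of_degree_eq (n := (∑ i, G.degree p i) * k) ?_
    rw [degree_mul, r.2.2, add_tsub_cancel_of_le hle]
  · refine MeasurableSpace.generateFrom_le ?_
    rintro _ ⟨p, -, rfl⟩
    exact G.measurableSet_cyl p

theorem measure_ext_rainbow [Fintype C] {μ ν : Measure G.InfPath} [IsFiniteMeasure μ]
    (h : ∀ p, G.IsRainbow p → μ (G.cyl p) = ν (G.cyl p)) : μ = ν := by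
  refine ext_of_generate_finite G.rainbowCyl G.measurableSpace_eq_generateFrom_rainbowCyl
    G.isPiSystem_rainbowCyl ?_ ?_
  · rintro _ ⟨p, hp, rfl⟩
    exact h p hp
  · rw [measure_univ_eq_sum, measure_univ_eq_sum]
    exact Finset.sum_congr rfl fun v _ => h _ (isRainbow_vertex v)

end Rainbow

end Cylinders

/-! ### The measure `M` -/

section PathMeasure

variable {k : ℕ} {C : Type u} [SmallCategory C] [Fintype C] [DecidableEq C] {G : KGraph k C}

/-- The mass `ρ(Λ)^{-d(p)} x^Λ_{s(p)}` of the cylinder set `[p]`. -/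
def mass (G : KGraph k C) (p : Arrow C) : ℝ := (G.rhoPow (G.degree p))⁻¹ * G.pfVector p.left

theorem mass_mul (p q : Arrow C) (h : p.left = q.right) :
    G.mass (mul p q h) = (G.rhoPow (G.degree p))⁻¹ * G.mass q := by
  rw [mass, degree_mul, rhoPow_add, mul_inv, _root_.mul_assoc, mul_left, mass]

variable [Nonempty C]

theorem rhoPow_pos (hfin : G.IsFinite) (hsrc : G.HasNoSources)
    (hpf : G.IsPerronFrobenius G.pfVector) (n : Fin k → ℕ) : 0 < G.rhoPow n :=
  one_pos.trans_le (one_le_rhoPow hfin hsrc hpf n)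

theorem mass_pos (hfin : G.IsFinite) (hsrc : G.HasNoSources)
    (hpf : G.IsPerronFrobenius G.pfVector) (p : Arrow C) : 0 < G.mass p :=
  mul_pos (inv_pos.2 (rhoPow_pos hfin hsrc hpf _)) (hpf.1 _)

/-- This is the eigenvector equation for `adjDeg n`, divided by ρ(Λ)^{d(p)+n}. It says that the
prescribed masses are consistent. -/
theorem sum_mass (hfin : G.IsFinite) (hsrc : G.HasNoSources)
    (hpf : G.IsPerronFrobenius G.pfVector) (p : Arrow C) (n : Fin k → ℕ)
    [Fintype (G.PathsTo p.left n)] :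
    ∑ r : G.PathsTo p.left n, G.mass (mul p r.1 r.2.1.symm) = G.mass p := by
  have h : ∀ r : G.PathsTo p.left n, G.mass (mul p r.1 r.2.1.symm)
      = (G.rhoPow (G.degree p))⁻¹ * ((G.rhoPow n)⁻¹ * G.pfVector r.1.left) := by
    rintro ⟨r, hr, rfl⟩
    exact mass_mul p r _
  rw [Finset.sum_congr rfl fun r _ => h r, ← Finset.mul_sum, ← Finset.mul_sum,
    sum_pfVector hfin hpf, inv_mul_cancel_left₀ (rhoPow_pos hfin hsrc hpf n).ne', mass]

open Classical in
-- `ν N` places the mass of each γ of degree (N,…,N) at a point of [γ]. By `sum_mass` its value on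
-- [p] is already the prescribed one once N dominates d(p), and so is that of the limit measure.
theorem exists_isPathMeasure (hfin : G.IsFinite) (hsrc : G.HasNoSources)
    (hpf : G.IsPerronFrobenius G.pfVector) : ∃ μ, G.IsPathMeasure μ := by
  choose pt hpt using fun p => cyl_nonempty hsrc p
  have := compactSpace hfin
  let ν : ℕ → Measure G.InfPath := fun N =>
    ∑ γ ∈ (hfin fun _ => N).toFinset, ENNReal.ofReal (G.mass γ) • Measure.dirac (pt γ)
  obtain ⟨μ, hμ⟩ := exists_measure_isClopen_eq G.measurableSpace_eq_generateFrom_isClopen ν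
  have key : ∀ p, μ (G.cyl p) = ENNReal.ofReal (G.mass p) := by
    intro p
    refine hμ _ ⟨isClosed_cyl p, isOpen_cyl p⟩ _ (tendsto_const_nhds.congr' ?_)
    filter_upwards [eventually_ge_atTop (∑ i, G.degree p i)] with N hN
    have hle : G.degree p ≤ fun _ => N := fun i =>
      (Finset.single_le_sum (f := G.degree p) (fun _ _ => Nat.zero_le _)
        (Finset.mem_univ i)).trans hN
    set n : Fin k → ℕ := (fun _ => N) - G.degree p
    have := hfin.finite_pathsTo p.left n
    have := Fintype.ofFinite (G.PathsTo p.left n)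
    rw [← sum_mass hfin hsrc hpf p n, ENNReal.ofReal_sum_of_nonneg
      fun r _ => (mass_pos hfin hsrc hpf _).le]
    simp only [ν, Measure.coe_finsetSum, Finset.sum_apply, Measure.smul_apply, smul_eq_mul,
      Measure.dirac_apply' _ (G.measurableSet_cyl p)]
    rw [← Finset.sum_subset (s₁ := Finset.univ.image
      fun r : G.PathsTo p.left n => mul p r.1 r.2.1.symm), Finset.sum_image]
    · refine Finset.sum_congr rfl fun r _ => ?_
      rw [Set.indicator_of_mem (cyl_subset_of_isPrefix (isPrefix_mul _ _ _) (hpt _)),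
        Pi.one_apply, mul_one]
    · exact (mul_pathsTo_injective p n).injOn
    · intro γ hγ
      simp only [Finset.mem_image, Finset.mem_univ, true_and] at hγ
      obtain ⟨r, rfl⟩ := hγ
      simp only [Set.Finite.mem_toFinset, Set.mem_ofPred_eq]
      rw [degree_mul, r.2.2, add_tsub_cancel_of_le hle]
    · intro γ hγ hγ'
      simp only [Set.Finite.mem_toFinset, Set.mem_ofPred_eq] at hγ
      rw [Set.indicator_of_notMem, mul_zero]
      intro hmem
      obtain ⟨r, hr, rfl⟩ := isPrefix_of_mem_cyl hmem (hpt γ) (by rw [hγ]; exact hle)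
      refine hγ' (Finset.mem_image.2 ⟨⟨r, hr.symm, ?_⟩, Finset.mem_univ _, rfl⟩)
      rw [degree_mul] at hγ
      exact eq_tsub_of_add_eq ((add_comm _ _).trans hγ)
  refine ⟨μ, ⟨?_⟩, key⟩
  rw [measure_univ_eq_sum, Finset.sum_congr rfl fun v _ => key (vertex v),
    ← ENNReal.ofReal_sum_of_nonneg fun v _ => (mass_pos hfin hsrc hpf _).le]
  simp [mass, hpf.2.1]

theorem isPathMeasure_M (hfin : G.IsFinite) (hsrc : G.HasNoSources)
    (hpf : G.IsPerronFrobenius G.pfVector) : G.IsPathMeasure G.M := by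
  have h := exists_isPathMeasure hfin hsrc hpf
  rw [M, dif_pos h]
  exact h.choose_spec

end PathMeasure

end

end KGraph

/-! ### The operators `S_p` -/

/-- The weighted composition operator `f ↦ 1_s (f ∘ σ)` is bounded on `L²(μ)` if the image under
`σ` of the restriction of `μ` to `s` is dominated by a multiple of `μ`. -/
theorem MeasureTheory.exists_continuousLinearMap_indicator_comp {X : Type*} [MeasurableSpace X]
    {μ : Measure X} {σ : X → X} (hσ : Measurable σ) {s : Set X} (hs : MeasurableSet s)
    {c : ℝ≥0∞} (hc : c ≠ ∞) (h : (μ.restrict s).map σ ≤ c • μ) :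
    ∃ T : Lp ℂ 2 μ →L[ℂ] Lp ℂ 2 μ, ∀ f, T f =ᵐ[μ] s.indicator fun x => f (σ x) := by
  -- Preimages of null sets meet `s` in null sets, so the operator is well defined on classes of
  -- functions.
  have hq : Measure.QuasiMeasurePreserving σ (μ.restrict s) μ :=
    ⟨hσ, (Measure.absolutelyContinuous_of_le h).trans Measure.smul_absolutelyContinuous⟩
  have hle : ∀ f : Lp ℂ 2 μ, eLpNorm (s.indicator fun x => f (σ x)) 2 μ
      ≤ c ^ (1 / 2 : ℝ≥0∞).toReal * eLpNorm f 2 μ := by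
    intro f
    rw [eLpNorm_indicator_eq_eLpNorm_restrict hs]
    refine (eLpNorm_map_measure (g := f) ?_ hσ.aemeasurable).symm.trans_le
      (eLpNorm_le_of_measure_le_smul h)
    exact (Lp.aestronglyMeasurable f).mono_ac hq.absolutelyContinuous
  have hK : c ^ (1 / 2 : ℝ≥0∞).toReal ≠ ∞ := ENNReal.rpow_ne_top_of_nonneg (by positivity) hc
  have hmem : ∀ f : Lp ℂ 2 μ, MemLp (s.indicator fun x => f (σ x)) 2 μ := fun f =>
    ⟨(aestronglyMeasurable_indicator_iff hs).2
      ((Lp.aestronglyMeasurable f).comp_quasiMeasurePreserving hq),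
      (hle f).trans_lt (ENNReal.mul_lt_top hK.lt_top (Lp.eLpNorm_lt_top f))⟩
  have hae : ∀ {P : X → Prop}, (∀ᵐ x ∂μ, P x) → ∀ᵐ x ∂μ, x ∈ s → P (σ x) := fun hP =>
    (ae_restrict_iff' hs).1 (hq.ae hP)
  let L : Lp ℂ 2 μ →ₗ[ℂ] Lp ℂ 2 μ :=
    { toFun := fun f => (hmem f).toLp
      map_add' := fun f g => by
        rw [← MemLp.toLp_add]
        refine MemLp.toLp_congr _ _ ?_
        filter_upwards [hae (Lp.coeFn_add f g)] with x hx
        by_cases hxs : x ∈ s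
        · simp only [Pi.add_apply, Set.indicator_of_mem hxs]
          exact hx hxs
        · simp [hxs]
      map_smul' := fun a f => by
        rw [RingHom.id_apply, ← MemLp.toLp_const_smul]
        refine MemLp.toLp_congr _ _ ?_
        filter_upwards [hae (Lp.coeFn_smul a f)] with x hx
        by_cases hxs : x ∈ s
        · simp only [Pi.smul_apply, Set.indicator_of_mem hxs]
          exact hx hxs
        · simp [hxs] }
  refine ⟨L.mkContinuous (c ^ (1 / 2 : ℝ≥0∞).toReal).toReal fun f => ?_, fun f =>
    (hmem f).coeFn_toLp⟩
  change ‖(hmem f).toLp‖ ≤ _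
  rw [Lp.norm_toLp, Lp.norm_def, ← ENNReal.toReal_mul]
  exact ENNReal.toReal_mono (ENNReal.mul_ne_top hK (Lp.eLpNorm_ne_top f)) (hle f)

namespace KGraph

noncomputable section

theorem continuous_shift {k : ℕ} {C : Type u} [SmallCategory C] {G : KGraph k C} (n : Fin k → ℕ) :
    Continuous (shift (G := G) n) := by
  refine continuous_generateFrom_iff.2 ?_
  rintro _ ⟨q, rfl⟩
  refine isOpen_iff_forall_mem_open.2 fun x hx => ?_
  have h : (G.seg x n).left = q.right := by
    refine shift_mem_cyl_right (mem_cyl_seg x n) ?_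
    rw [degree_seg]
    exact hx
  refine ⟨G.cyl (mul (G.seg x n) q h), fun y hy => ?_, isOpen_cyl _, ?_⟩
  · have := ((mem_cyl_mul _).1 hy).2
    rwa [degree_seg] at this
  · rw [mem_cyl_mul, degree_seg]
    exact ⟨mem_cyl_seg x n, hx⟩

section Operators

variable {k : ℕ} {C : Type u} [SmallCategory C] [Fintype C] [DecidableEq C] {G : KGraph k C}

theorem measure_cyl (hM : G.IsPathMeasure G.M) (p : Arrow C) :
    G.M (G.cyl p) = ENNReal.ofReal (G.mass p) := hM.2 p

variable [Nonempty C]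

/-- Both measures agree on cylinders of Bratteli paths because M[pq] = ρ(Λ)^{-d(p)} M[q]. The
identity provides the domination that makes composition with the shift bounded. -/
theorem map_shift_restrict [NeZero k] (hfin : G.IsFinite) (hsrc : G.HasNoSources)
    (hpf : G.IsPerronFrobenius G.pfVector) (hM : G.IsPathMeasure G.M) (p : Arrow C) :
    (G.M.restrict (G.cyl p)).map (shift (G.degree p))
      = ENNReal.ofReal (G.rhoPow (G.degree p))⁻¹ • G.M.restrict (G.cyl (vertex p.left)) := by
  have hm := (continuous_shift (G := G) (G.degree p)).measurable
  refine measure_ext_rainbow fun q _ => ?_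
  rw [Measure.map_apply hm (G.measurableSet_cyl q),
    Measure.restrict_apply (hm (G.measurableSet_cyl q)), Measure.smul_apply,
    Measure.restrict_apply (G.measurableSet_cyl q), smul_eq_mul]
  by_cases h : p.left = q.right
  · have h1 : shift (G.degree p) ⁻¹' G.cyl q ∩ G.cyl p = G.cyl (mul p q h) := by
      ext x
      rw [mem_cyl_mul, and_comm]
      rfl
    have h2 : G.cyl q ∩ G.cyl (vertex p.left) = G.cyl q :=
      Set.inter_eq_left.2 (cyl_subset_of_isPrefix ⟨q, h, vertex_mul _ _ h⟩)
    rw [h1, h2, measure_cyl hM, measure_cyl hM, mass_mul,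
      ENNReal.ofReal_mul (inv_nonneg.2 (rhoPow_pos hfin hsrc hpf _).le)]
  · have h1 : shift (G.degree p) ⁻¹' G.cyl q ∩ G.cyl p = ∅ :=
      Set.eq_empty_of_forall_notMem fun x hx => h (shift_mem_cyl_right hx.2 hx.1)
    have h2 : G.cyl q ∩ G.cyl (vertex p.left) = ∅ := by
      refine Set.eq_empty_of_forall_notMem fun x hx => h ?_
      have := isPrefix_of_mem_cyl hx.2 hx.1 (by
        rw [degree_vertex]
        exact fun i => Nat.zero_le _)
      exact this.right_eq
    rw [h1, h2, measure_empty, mul_zero]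

/-- The operator is f ↦ ρ(Λ)^{d(p)/2} 1_[p] (f ∘ σ^{d(p)}). Points of [p] whose shift lies in [q]
form [pq] if the product is defined, and the empty set otherwise. -/
theorem exists_isScalingOperator [NeZero k] (hfin : G.IsFinite) (hsrc : G.HasNoSources)
    (hpf : G.IsPerronFrobenius G.pfVector) (hM : G.IsPathMeasure G.M) (p : Arrow C) :
    ∃ T, G.IsScalingOperator p T := by
  have hm := (continuous_shift (G := G) (G.degree p)).measurable
  obtain ⟨T, hT⟩ := exists_continuousLinearMap_indicator_comp hm (G.measurableSet_cyl p)
    ENNReal.ofReal_ne_top (c := ENNReal.ofReal (G.rhoPow (G.degree p))⁻¹) (μ := G.M) (by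
      rw [map_shift_restrict hfin hsrc hpf hM]
      gcongr
      exact Measure.restrict_le_self)
  have hq : Measure.QuasiMeasurePreserving (shift (G.degree p)) (G.M.restrict (G.cyl p)) G.M := by
    refine ⟨hm, ?_⟩
    rw [map_shift_restrict hfin hsrc hpf hM]
    exact Measure.smul_absolutelyContinuous.trans Measure.restrict_le_self.absolutelyContinuous
  have key : ∀ q : Arrow C, T (G.chi q) =ᵐ[G.M]
      (G.cyl p ∩ shift (G.degree p) ⁻¹' G.cyl q).indicator fun _ => (1 : ℂ) := by
    intro q
    have h2 : ∀ᵐ x ∂G.M, x ∈ G.cyl p → G.chi q (shift (G.degree p) x)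
        = (G.cyl q).indicator (fun _ => (1 : ℂ)) (shift (G.degree p) x) :=
      (ae_restrict_iff' (G.measurableSet_cyl p)).1 (hq.ae indicatorConstLp_coeFn)
    filter_upwards [hT (G.chi q), h2] with x hx hx2
    rw [hx]
    by_cases hp : x ∈ G.cyl p
    · rw [Set.indicator_of_mem hp, hx2 hp]
      by_cases hq : shift (G.degree p) x ∈ G.cyl q
      · rw [Set.indicator_of_mem hq, Set.indicator_of_mem (Set.mem_inter hp hq)]
      · rw [Set.indicator_of_notMem hq, Set.indicator_of_notMem fun h => hq h.2]
    · rw [Set.indicator_of_notMem hp, Set.indicator_of_notMem fun h => hp h.1]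
  refine ⟨((Real.sqrt (G.rhoPow (G.degree p)) : ℝ) : ℂ) • T, fun q => ⟨fun h => ?_, fun h => ?_⟩⟩
  · rw [_root_.smul_apply]
    congr 1
    refine Lp.ext ((key q).trans ?_)
    have : G.cyl p ∩ shift (G.degree p) ⁻¹' G.cyl q = G.cyl (mul p q h) := by
      ext x
      rw [mem_cyl_mul]
      rfl
    rw [this]
    exact indicatorConstLp_coeFn.symm
  · rw [_root_.smul_apply]
    have h0 : T (G.chi q) = 0 := by
      refine Lp.ext ((key q).trans ?_)
      have : G.cyl p ∩ shift (G.degree p) ⁻¹' G.cyl q = ∅ :=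
        Set.eq_empty_of_forall_notMem fun x hx => h (shift_mem_cyl_right hx.1 hx.2)
      rw [this, Set.indicator_empty]
      exact (Lp.coeFn_zero _ _ _).symm
    rw [h0, smul_zero]

theorem isScalingOperator_S [NeZero k] (hfin : G.IsFinite) (hsrc : G.HasNoSources)
    (hpf : G.IsPerronFrobenius G.pfVector) (hM : G.IsPathMeasure G.M) (p : Arrow C) :
    G.IsScalingOperator p (G.S p) := by
  have h := exists_isScalingOperator hfin hsrc hpf hM p
  rw [S, dif_pos h]
  exact h.choose_spec

end Operators

end

end KGraph

/-! ### Extension by one edge, and the spaces it adds -/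

namespace KGraph

noncomputable section

section Colors

variable {k : ℕ} [NeZero k]

theorem ofNat_mul_add (q : ℕ) (j : Fin k) : Fin.ofNat k (q * k + (j : ℕ)) = j := by
  ext
  rw [Fin.val_ofNat, Nat.mul_add_mod', Nat.mod_eq_of_lt j.2]

theorem rainbow_mul_add_succ (q : ℕ) (j : Fin k) :
    rainbow k (q * k + (j : ℕ) + 1) = rainbow k (q * k + (j : ℕ)) + Pi.single j 1 := by
  rw [rainbow_succ, ofNat_mul_add]

end Colors

section Extend

variable {k : ℕ} {C : Type u} [SmallCategory C] {G : KGraph k C}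

theorem degree_extend {j : Fin k} (p : Arrow C) (e : G.Edge p.left j) :
    G.degree (G.extend p e) = G.degree p + Pi.single j 1 := by
  rw [extend, degree_mul, e.2.2]

theorem isPrefix_extend {j : Fin k} (p : Arrow C) (e : G.Edge p.left j) :
    IsPrefix p (G.extend p e) := isPrefix_mul _ _ _

theorem extend_injective {j : Fin k} (p : Arrow C) :
    Function.Injective (G.extend p (j := j)) := mul_pathsTo_injective p _

theorem finite_edge (hfin : G.IsFinite) (v : C) (j : Fin k) : Finite (G.Edge v j) :=
  hfin.finite_pathsTo v (Pi.single j 1)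

theorem mul_extend {j : Fin k} (p η : Arrow C) (h : p.left = η.right) (e : G.Edge η.left j) :
    mul p (G.extend η e) h = G.extend (mul p η h) e :=
  (mul_assoc p η e.1 h e.2.1.symm).symm

end Extend

variable {k : ℕ} {C : Type u} [SmallCategory C] [Fintype C] [DecidableEq C] {G : KGraph k C}

/-- A finite `k`-graph without sources whose Perron-Frobenius eigenvector, path measure and scaling
operators have their defining properties. -/
structure IsRegular (G : KGraph k C) : Prop where
  finite : G.IsFinite
  noSources : G.HasNoSources
  perronFrobenius : G.IsPerronFrobenius G.pfVector
  pathMeasure : G.IsPathMeasure G.M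
  scaling : ∀ p, G.IsScalingOperator p (G.S p)

/-- The space spanned by the characteristic functions of the cylinder sets of the paths of length
`n` in the Bratteli diagram. -/
def cylSpan (G : KGraph k C) (n : ℕ) : Submodule ℂ G.L2 :=
  Submodule.span ℂ (G.chi '' {p | G.degree p = rainbow k n})

/-- The combinations of the `χ_[γe]`, for edges `e` of color `j`, that have integral `0`. -/
def detail (G : KGraph k C) (j : Fin k) (γ : Arrow C) : Submodule ℂ G.L2 :=
  Submodule.span ℂ {f | ∃ b : G.Edge γ.left j → ℂ,
    ∑ᶠ e, b e * (G.mass (G.extend γ e) : ℂ) = 0 ∧ f = ∑ᶠ e, b e • G.chi (G.extend γ e)}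

/-- The sum of the spaces `G.detail j γ` over all paths `γ` of length `n` in the Bratteli
diagram. -/
def detailSpace (G : KGraph k C) (n : ℕ) (j : Fin k) : Submodule ℂ G.L2 :=
  ⨆ γ ∈ {γ : Arrow C | G.degree γ = rainbow k n}, G.detail j γ

namespace IsRegular

variable (hG : G.IsRegular)
include hG

theorem measureReal_cyl [Nonempty C] (p : Arrow C) : G.M.real (G.cyl p) = G.mass p := by
  rw [Measure.real, measure_cyl hG.pathMeasure, ENNReal.toReal_ofReal
    (mass_pos hG.finite hG.noSources hG.perronFrobenius p).le]

end IsRegular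

end

end KGraph

/-! ### Splitting off the integral-zero combinations -/

namespace KGraph

noncomputable section

variable {k : ℕ} {C : Type u} [SmallCategory C] [Fintype C] [DecidableEq C] {G : KGraph k C}

theorem finsum_smul_chi {j : Fin k} (γ : Arrow C) [Fintype (G.Edge γ.left j)]
    (b : G.Edge γ.left j → ℂ) : ∑ᶠ e, b e • G.chi (G.extend γ e)
      = Fintype.linearCombination ℂ (fun e => G.chi (G.extend γ e)) b :=
  finsum_eq_sum_of_fintype _

theorem cylSpan_mul [NeZero k] (q : ℕ) : G.cylSpan (q * k) = G.V q := by
  rw [cylSpan, V, rainbow_mul]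
  congr 1
  ext f
  simp [Set.mem_image, eq_comm]

namespace IsRegular

variable [Nonempty C] (hG : G.IsRegular)
include hG

theorem mass_ne_zero (p : Arrow C) : (G.mass p : ℂ) ≠ 0 :=
  Complex.ofReal_ne_zero.2 (mass_pos hG.finite hG.noSources hG.perronFrobenius p).ne'

theorem inner_chi_of_isPrefix {p q : Arrow C} (h : IsPrefix p q) :
    inner ℂ (G.chi p) (G.chi q) = (G.mass q : ℂ) := by
  rw [chi, chi, L2.inner_indicatorConstLp_one_indicatorConstLp_one,
    Set.inter_eq_right.2 (cyl_subset_of_isPrefix h), hG.measureReal_cyl]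
  rfl

omit [Nonempty C] hG in
theorem inner_chi_of_disjoint {p q : Arrow C} (h : Disjoint (G.cyl p) (G.cyl q)) :
    inner ℂ (G.chi p) (G.chi q) = 0 := by
  rw [chi, chi, L2.inner_indicatorConstLp_one_indicatorConstLp_one,
    Set.disjoint_iff_inter_eq_empty.1 h]
  simp

/-- The difference of the two sides is orthogonal to each of the vectors it is built from, hence to
itself. -/
theorem chi_eq_sum (p : Arrow C) (n : Fin k → ℕ) [Fintype (G.PathsTo p.left n)] :
    G.chi p = ∑ r : G.PathsTo p.left n, G.chi (mul p r.1 r.2.1.symm) := by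
  classical
  rw [← sub_eq_zero, ← inner_self_eq_zero (𝕜 := ℂ)]
  set v := G.chi p - ∑ r : G.PathsTo p.left n, G.chi (mul p r.1 r.2.1.symm) with hv
  have h1 : inner ℂ (G.chi p) v = 0 := by
    rw [hv, inner_sub_right, inner_sum, hG.inner_chi_of_isPrefix (IsPrefix.refl p),
      Finset.sum_congr rfl fun r _ => hG.inner_chi_of_isPrefix (isPrefix_mul p r.1 r.2.1.symm),
      ← Complex.ofReal_sum, sum_mass hG.finite hG.noSources hG.perronFrobenius, sub_self]
  have h2 : ∀ r : G.PathsTo p.left n, inner ℂ (G.chi (mul p r.1 r.2.1.symm)) v = 0 := by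
    intro r
    rw [hv, inner_sub_right, inner_sum, ← inner_conj_symm,
      hG.inner_chi_of_isPrefix (isPrefix_mul p r.1 r.2.1.symm), Complex.conj_ofReal,
      Finset.sum_eq_single r, hG.inner_chi_of_isPrefix (IsPrefix.refl _), sub_self]
    · intro s _ hs
      exact inner_chi_of_disjoint (pairwise_disjoint_cyl_mul p n hs.symm)
    · simp
  conv_lhs => rw [hv]
  rw [inner_sub_left, sum_inner, h1, Finset.sum_congr rfl fun r _ => h2 r]
  simp

theorem inner_linearCombination {j : Fin k} (γ : Arrow C) [Fintype (G.Edge γ.left j)]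
    (a b : G.Edge γ.left j → ℂ) :
    inner ℂ (Fintype.linearCombination ℂ (fun e => G.chi (G.extend γ e)) a)
      (Fintype.linearCombination ℂ (fun e => G.chi (G.extend γ e)) b)
      = ∑ e, (starRingEnd ℂ) (a e) * b e * (G.mass (G.extend γ e) : ℂ) := by
  classical
  simp only [Fintype.linearCombination_apply, sum_inner, inner_sum, inner_smul_left,
    inner_smul_right]
  refine Finset.sum_congr rfl fun e _ => ?_
  rw [Finset.sum_eq_single e, hG.inner_chi_of_isPrefix (IsPrefix.refl _), _root_.mul_assoc,
    mul_left_comm]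
  · intro e' _ he
    rw [inner_chi_of_disjoint (disjoint_cyl (by rw [degree_extend, degree_extend])
      ((extend_injective γ).ne he)), mul_zero]
  · simp

omit [Nonempty C] hG in
theorem inner_linearCombination_of_ne {j : Fin k} {γ γ' : Arrow C} [Fintype (G.Edge γ.left j)]
    [Fintype (G.Edge γ'.left j)] (hd : G.degree γ = G.degree γ') (hne : γ ≠ γ')
    (a : G.Edge γ.left j → ℂ) (b : G.Edge γ'.left j → ℂ) :
    inner ℂ (Fintype.linearCombination ℂ (fun e => G.chi (G.extend γ e)) a)
      (Fintype.linearCombination ℂ (fun e => G.chi (G.extend γ' e)) b) = 0 := by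
  simp only [Fintype.linearCombination_apply, sum_inner, inner_sum, inner_smul_left,
    inner_smul_right]
  refine Finset.sum_eq_zero fun e' _ => mul_eq_zero_of_right _
    (Finset.sum_eq_zero fun e _ => ?_)
  rw [inner_chi_of_disjoint ((disjoint_cyl hd hne).mono (cyl_subset_of_isPrefix
    (isPrefix_extend γ e)) (cyl_subset_of_isPrefix (isPrefix_extend γ' e'))), mul_zero]

/-- A cylinder of the same degree as γ is either disjoint from [γ] or equal to it; in the latter
case the inner product is the vanishing integral. -/
theorem detail_isOrtho (n : ℕ) (j : Fin k) : G.detailSpace n j ⟂ G.cylSpan n := by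
  classical
  rw [detailSpace]
  simp only [Submodule.isOrtho_iSup_left]
  intro γ hγ
  refine Submodule.IsOrtho.symm (Submodule.isOrtho_span.2 ?_)
  rintro _ ⟨p, hp, rfl⟩ _ ⟨b, hb, rfl⟩
  have := finite_edge hG.finite γ.left j
  have := Fintype.ofFinite (G.Edge γ.left j)
  rw [finsum_eq_sum_of_fintype] at hb ⊢
  rw [inner_sum]
  simp only [inner_smul_right]
  by_cases h : p = γ
  · subst h
    rw [← hb]
    exact Finset.sum_congr rfl fun e _ => by
      rw [hG.inner_chi_of_isPrefix (isPrefix_extend p e)]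
  · refine Finset.sum_eq_zero fun e _ => ?_
    rw [inner_chi_of_disjoint ((disjoint_cyl (hp.trans hγ.symm) h).mono_right
      (cyl_subset_of_isPrefix (isPrefix_extend γ e))), mul_zero]

omit [Nonempty C] in
theorem detailSpace_le {n : ℕ} {j : Fin k}
    (h : rainbow k (n + 1) = rainbow k n + Pi.single j 1) :
    G.detailSpace n j ≤ G.cylSpan (n + 1) := by
  refine iSup₂_le fun γ hγ => Submodule.span_le.2 ?_
  rintro _ ⟨b, -, rfl⟩
  have := finite_edge hG.finite γ.left j
  have := Fintype.ofFinite (G.Edge γ.left j)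
  rw [finsum_eq_sum_of_fintype]
  refine Submodule.sum_mem _ fun e _ => Submodule.smul_mem _ _ (Submodule.subset_span ⟨_, ?_, rfl⟩)
  rw [Set.mem_ofPred_eq, degree_extend, h]
  exact congrArg (· + _) hγ

theorem cylSpan_le_succ {n : ℕ} {j : Fin k}
    (h : rainbow k (n + 1) = rainbow k n + Pi.single j 1) :
    G.cylSpan n ≤ G.cylSpan (n + 1) := by
  refine Submodule.span_le.2 ?_
  rintro _ ⟨γ, hγ, rfl⟩
  have := hG.finite.finite_pathsTo γ.left (Pi.single j 1)
  have := Fintype.ofFinite (G.PathsTo γ.left (Pi.single j 1))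
  rw [hG.chi_eq_sum γ (Pi.single j 1)]
  refine Submodule.sum_mem _ fun e _ => Submodule.subset_span ⟨_, ?_, rfl⟩
  rw [Set.mem_ofPred_eq, degree_mul, e.2.2, h]
  exact congrArg (· + _) hγ

/-- χ_[γe₀] is its projection t χ_[γ], with t = M[γe₀] / M[γ], plus a combination of the χ_[γe] with
integral zero. -/
theorem cylSpan_succ_le {n : ℕ} {j : Fin k}
    (h : rainbow k (n + 1) = rainbow k n + Pi.single j 1) :
    G.cylSpan (n + 1) ≤ G.cylSpan n ⊔ G.detailSpace n j := by
  classical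
  refine Submodule.span_le.2 ?_
  rintro _ ⟨p, hp, rfl⟩
  obtain ⟨γ, r, hγr, hγ, hr, rfl⟩ := exists_mul_eq (G := G) (p := p) (hp.trans h)
  have := finite_edge hG.finite γ.left j
  have := Fintype.ofFinite (G.Edge γ.left j)
  let e₀ : G.Edge γ.left j := ⟨r, hγr.symm, hr⟩
  have hchi : G.chi γ = ∑ e : G.Edge γ.left j, G.chi (G.extend γ e) :=
    let _ : Fintype (G.PathsTo γ.left (Pi.single j 1)) :=
      inferInstanceAs (Fintype (G.Edge γ.left j))
    hG.chi_eq_sum γ (Pi.single j 1)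
  have hmass : ∑ e : G.Edge γ.left j, (G.mass (G.extend γ e) : ℂ) = G.mass γ := by
    let _ : Fintype (G.PathsTo γ.left (Pi.single j 1)) :=
      inferInstanceAs (Fintype (G.Edge γ.left j))
    rw [← sum_mass hG.finite hG.noSources hG.perronFrobenius γ (Pi.single j 1),
      Complex.ofReal_sum]
    rfl
  set t : ℂ := (G.mass (G.extend γ e₀) : ℂ) / G.mass γ
  have ht : t * G.mass γ = G.mass (G.extend γ e₀) := div_mul_cancel₀ _ (hG.mass_ne_zero γ)
  have key : G.chi (G.extend γ e₀)
      = t • G.chi γ + ∑ e, ((if e = e₀ then 1 else 0) - t) • G.chi (G.extend γ e) := by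
    simp only [sub_smul, Finset.sum_sub_distrib, ← Finset.smul_sum, ← hchi, ite_smul, one_smul,
      zero_smul, Finset.sum_ite_eq', Finset.mem_univ, if_true]
    abel
  change G.chi (G.extend γ e₀) ∈ _
  rw [key]
  refine add_mem (Submodule.mem_sup_left (Submodule.smul_mem _ _ (Submodule.subset_span
    ⟨γ, hγ, rfl⟩))) (Submodule.mem_sup_right ?_)
  refine Submodule.mem_iSup_of_mem γ (Submodule.mem_iSup_of_mem hγ (Submodule.subset_span
    ⟨fun e => (if e = e₀ then 1 else 0) - t, ?_, ?_⟩))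
  · rw [finsum_eq_sum_of_fintype]
    simp only [sub_mul, Finset.sum_sub_distrib, ← Finset.mul_sum, hmass, ite_mul, one_mul,
      zero_mul, Finset.sum_ite_eq', Finset.mem_univ, if_true]
    rw [ht, sub_self]
  · rw [finsum_eq_sum_of_fintype]

omit [Nonempty C] in
theorem finiteDimensional_cylSpan (n : ℕ) : FiniteDimensional ℂ (G.cylSpan n) :=
  FiniteDimensional.span_of_finite ℂ ((hG.finite _).image _)

omit [Nonempty C] in
-- A function orthogonal to all these spaces has integral zero over a generating π-system and over
-- the whole space, hence over every Borel set.
theorem iSup_cylSpan_orthogonal [NeZero k] : (⨆ n, G.cylSpan n)ᗮ = ⊥ := by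
  refine (Submodule.eq_bot_iff _).2 fun f hf => ?_
  have := hG.pathMeasure.1
  have hint : Integrable f G.M := (Lp.memLp f).integrable (by norm_num)
  have h0 : ∀ p, G.IsRainbow p → ∫ x in G.cyl p, f x ∂G.M = 0 := by
    intro p hp
    rw [← L2.inner_indicatorConstLp_one (G.measurableSet_cyl p) (measure_ne_top G.M _) f]
    refine (Submodule.mem_orthogonal _ f).1 hf (G.chi p)
      (Submodule.mem_iSup_of_mem (G.length p) (Submodule.subset_span ⟨p, hp, rfl⟩))
  have huniv : ∫ x, f x ∂G.M = 0 := by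
    rw [← setIntegral_univ, ← iUnion_cyl_vertex,
      integral_iUnion (fun _ => G.measurableSet_cyl _) pairwise_disjoint_cyl_vertex
        hint.integrableOn]
    simp [h0 _ (isRainbow_vertex _)]
  have hall : ∀ s, MeasurableSet s → ∫ x in s, f x ∂G.M = 0 := by
    refine MeasurableSpace.induction_on_inter G.measurableSpace_eq_generateFrom_rainbowCyl
      G.isPiSystem_rainbowCyl (by simp) ?_ ?_ ?_
    · rintro _ ⟨p, hp, rfl⟩
      exact h0 p hp
    · intro t ht h
      have := integral_add_compl ht hint
      rwa [h, huniv, zero_add] at this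
    · intro t hd ht h
      rw [integral_iUnion ht hd hint.integrableOn]
      simp [h]
  exact (Lp.eq_zero_iff_ae_eq_zero).2 (Lp.ae_eq_zero_of_forall_setIntegral_eq_zero f (by norm_num)
    (by norm_num) (fun s _ _ => hint.integrableOn) fun s hs _ => hall s hs)

end IsRegular

end

end KGraph

/-! ### Wavelets -/

namespace KGraph

noncomputable section

variable {k : ℕ} {C : Type u} [SmallCategory C] [Fintype C] [DecidableEq C] {G : KGraph k C}

theorem mother_eq {j : Fin k} (c : G.CoeffFamily) (η : Arrow C) [Fintype (G.Edge η.left j)]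
    (l : Fin (Nat.card (G.Edge η.left j) - 1)) :
    G.mother c j η l
      = Fintype.linearCombination ℂ (fun e => G.chi (G.extend η e)) (c j η l) :=
  finsum_smul_chi η (c j η l)

theorem mass_extend_mul {j : Fin k} (p η : Arrow C) (h : p.left = η.right)
    (e : G.Edge η.left j) : G.mass (G.extend (mul p η h) e)
      = (G.rhoPow (G.degree p))⁻¹ * G.mass (G.extend η e) :=
  (congrArg G.mass (mul_extend p η h e)).symm.trans (mass_mul p (G.extend η e) h)

namespace IsRegular

variable [Nonempty C] (hG : G.IsRegular)
include hG

theorem edgeInner_eq {j : Fin k} (η : Arrow C) [Fintype (G.Edge η.left j)]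
    (a b : G.Edge η.left j → ℂ) : G.edgeInner η a b
      = ∑ e, (starRingEnd ℂ) (a e) * b e * (G.mass (G.extend η e) : ℂ) := by
  rw [edgeInner, finsum_eq_sum_of_fintype]
  simp only [hG.measureReal_cyl]

theorem sqrt_rhoPow_ne_zero (n : Fin k → ℕ) : ((Real.sqrt (G.rhoPow n) : ℝ) : ℂ) ≠ 0 :=
  Complex.ofReal_ne_zero.2
    (Real.sqrt_pos.2 (rhoPow_pos hG.finite hG.noSources hG.perronFrobenius n)).ne'

omit [Nonempty C] in
theorem S_linearCombination {j : Fin k} (p η : Arrow C) [Fintype (G.Edge η.left j)]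
    (h : p.left = η.right) (b : G.Edge η.left j → ℂ) :
    G.S p (Fintype.linearCombination ℂ (fun e => G.chi (G.extend η e)) b)
      = ((Real.sqrt (G.rhoPow (G.degree p)) : ℝ) : ℂ) •
        ∑ e, b e • G.chi (G.extend (mul p η h) e) := by
  rw [Fintype.linearCombination_apply, map_sum, Finset.smul_sum]
  refine Finset.sum_congr rfl fun e _ => ?_
  rw [map_smul, (hG.scaling p (G.extend η e)).1 h, smul_comm, mul_extend p η h e]

omit [Nonempty C] in
theorem S_mother_eq_zero {j : Fin k} (c : G.CoeffFamily) (p : Arrow C) (i : G.MotherIndex j)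
    (h : p.left ≠ i.base.right) : G.S p (G.mother c j i.base i.idx) = 0 := by
  have := finite_edge hG.finite i.base.left j
  have := Fintype.ofFinite (G.Edge i.base.left j)
  rw [mother_eq, Fintype.linearCombination_apply, map_sum]
  refine Finset.sum_eq_zero fun e _ => ?_
  rw [map_smul, (hG.scaling p (G.extend i.base e)).2 h, smul_zero]

theorem orthonormal_mother {c : G.CoeffFamily} (hc : G.IsWaveletCoeff c) (j : Fin k) :
    Orthonormal ℂ (fun i : G.MotherIndex j => G.mother c j i.base i.idx) := by
  classical
  refine orthonormal_iff_ite.2 ?_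
  rintro ⟨η, hη, l⟩ ⟨η', hη', l'⟩
  have := fun v => finite_edge hG.finite v j
  have := fun v => Fintype.ofFinite (G.Edge v j)
  simp only [mother_eq]
  by_cases h : η = η'
  · subst h
    rw [hG.inner_linearCombination, ← hG.edgeInner_eq, (hc j η hη).1]
    simp only [MotherIndex.mk.injEq, heq_eq_eq, true_and]
  · rw [inner_linearCombination_of_ne (hη.trans hη'.symm) h, if_neg]
    exact fun e => h (congrArg MotherIndex.base e)

/-- By unique factorization, distinct pairs (p, η) give distinct products of one degree, hence
disjoint supports. For equal pairs the square of ρ(Λ)^{d(p)/2} cancels the scaling M[pηe] =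
ρ(Λ)^{-d(p)} M[ηe]. -/
theorem orthonormal_wavelet {c : G.CoeffFamily} (hc : G.IsWaveletCoeff c) (q : ℕ) (j : Fin k) :
    Orthonormal ℂ
      (fun i : G.WaveletIndex q j => G.S i.path (G.mother c j i.base i.idx)) := by
  classical
  refine orthonormal_iff_ite.2 ?_
  rintro ⟨⟨η, hη, l⟩, p, hp, hc1⟩ ⟨⟨η', hη', l'⟩, p', hp', hc2⟩
  dsimp only at hc1 hc2
  have := fun v => finite_edge hG.finite v j
  have := fun v => Fintype.ofFinite (G.Edge v j)
  simp only [mother_eq]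
  rw [hG.S_linearCombination p η hc1, hG.S_linearCombination p' η' hc2, inner_smul_left,
    inner_smul_right, Complex.conj_ofReal]
  by_cases h : mul p η hc1 = mul p' η' hc2
  · obtain ⟨rfl, rfl⟩ := mul_inj h (hp.trans hp'.symm)
    have hρ := rhoPow_pos hG.finite hG.noSources hG.perronFrobenius (G.degree p)
    have e1 : inner ℂ (∑ e : G.Edge η.left j, c j η l e • G.chi (G.extend (mul p η hc1) e))
        (∑ e : G.Edge η.left j, c j η l' e • G.chi (G.extend (mul p η hc1) e))
        = ∑ e : G.Edge η.left j, (starRingEnd ℂ) (c j η l e) * c j η l' e *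
          (G.mass (G.extend (mul p η hc1) e) : ℂ) :=
      hG.inner_linearCombination (mul p η hc1) (c j η l) (c j η l')
    have e2 := (hc j η hη).1 l l'
    rw [hG.edgeInner_eq] at e2
    refine (congrArg (fun z : ℂ => ((Real.sqrt (G.rhoPow (G.degree p)) : ℝ) : ℂ) *
      (((Real.sqrt (G.rhoPow (G.degree p)) : ℝ) : ℂ) * z)) e1).trans ?_
    simp only [WaveletIndex.mk.injEq, MotherIndex.mk.injEq, heq_eq_eq, true_and, and_true]
    rw [← e2, ← _root_.mul_assoc, ← Complex.ofReal_mul, Real.mul_self_sqrt hρ.le, Finset.mul_sum]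
    refine Finset.sum_congr rfl fun e _ => ?_
    rw [mass_extend_mul]
    have hρ' : (G.rhoPow (G.degree p) : ℂ) ≠ 0 := Complex.ofReal_ne_zero.2 hρ.ne'
    push_cast
    field_simp
  · have hd : G.degree (mul p η hc1) = G.degree (mul p' η' hc2) := by
      rw [degree_mul, degree_mul, hp, hp', hη, hη']
    have e1 : inner ℂ (∑ e : G.Edge η.left j, c j η l e • G.chi (G.extend (mul p η hc1) e))
        (∑ e : G.Edge η'.left j, c j η' l' e • G.chi (G.extend (mul p' η' hc2) e)) = 0 :=
      inner_linearCombination_of_ne hd h (j := j) (c j η l) (c j η' l')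
    rw [if_neg]
    · refine (congrArg (fun z : ℂ => ((Real.sqrt (G.rhoPow (G.degree p)) : ℝ) : ℂ) *
        (((Real.sqrt (G.rhoPow (G.degree p')) : ℝ) : ℂ) * z)) e1).trans ?_
      simp
    · intro e
      simp only [WaveletIndex.mk.injEq, MotherIndex.mk.injEq] at e
      obtain ⟨⟨rfl, -⟩, rfl⟩ := e
      exact h rfl

/-- The bridge between wavelets and integral-zero combinations. For γ = pη, the integral of ∑_e b_e
χ_[γe] is a nonzero multiple of the pairing of b with (1,…,1) over the [ηe] (`hzero`), so the
vectors (c_j)^{ℓ,η} span exactly the admissible coefficients b. -/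
theorem refinedW_eq [NeZero k] {c : G.CoeffFamily} (hc : G.IsWaveletCoeff c) (q : ℕ)
    (j : Fin k) : G.refinedW c q j = G.detailSpace (q * k + j) j := by
  have := fun v => finite_edge hG.finite v j
  have := fun v => Fintype.ofFinite (G.Edge v j)
  have hzero : ∀ (p η : Arrow C) (h : p.left = η.right) (b : G.Edge η.left j → ℂ),
      ∑ e, b e * (G.mass (G.extend (mul p η h) e) : ℂ)
        = ((G.rhoPow (G.degree p))⁻¹ : ℝ) * G.edgeInner η (fun _ => 1) b := by
    intro p η h b
    rw [hG.edgeInner_eq, Finset.mul_sum]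
    refine Finset.sum_congr rfl fun e _ => ?_
    rw [mass_extend_mul, map_one, one_mul, Complex.ofReal_mul]
    ring
  apply le_antisymm
  · refine Submodule.span_le.2 ?_
    rintro _ ⟨p, i, hp, rfl⟩
    by_cases h : p.left = i.base.right
    · rw [mother_eq, hG.S_linearCombination p i.base h]
      refine Submodule.smul_mem _ _ (Submodule.mem_iSup_of_mem (mul p i.base h)
        (Submodule.mem_iSup_of_mem ?_ (Submodule.subset_span ⟨c j i.base i.idx, ?_, ?_⟩)))
      · rw [Set.mem_ofPred_eq, degree_mul, hp, i.degree_base, rainbow_mul_add_eq]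
      · refine (finsum_eq_sum_of_fintype (α := G.Edge i.base.left j) _).trans ?_
        refine (hzero p i.base h _).trans ?_
        rw [((hc j i.base i.degree_base).2 _).1 (Submodule.subset_span ⟨_, rfl⟩), mul_zero]
      · exact (finsum_eq_sum_of_fintype (α := G.Edge i.base.left j) _).symm
    · rw [hG.S_mother_eq_zero c p i h]
      exact zero_mem _
  · refine iSup₂_le fun γ hγ => Submodule.span_le.2 ?_
    rintro _ ⟨b, hb, rfl⟩
    obtain ⟨p, η, h, hp, hη, rfl⟩ :=
      exists_mul_eq (G := G) (p := γ) (hγ.trans (rainbow_mul_add_eq q j))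
    change ∑ᶠ e : G.Edge η.left j, b e * (G.mass (G.extend (mul p η h) e) : ℂ) = 0 at hb
    rw [finsum_eq_sum_of_fintype] at hb
    replace hb := (hzero p η h b).symm.trans hb
    have hρ := rhoPow_pos hG.finite hG.noSources hG.perronFrobenius (G.degree p)
    have hb0 := (mul_eq_zero.1 hb).resolve_left (Complex.ofReal_ne_zero.2 (inv_pos.2 hρ).ne')
    have hspan := ((hc j η hη).2 b).2 hb0
    change ∑ᶠ e : G.Edge η.left j, b e • G.chi (G.extend (mul p η h) e) ∈ _
    rw [finsum_eq_sum_of_fintype, ← Fintype.linearCombination_apply ℂ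
      (fun e : G.Edge η.left j => G.chi (G.extend (mul p η h) e)) b]
    -- The linear map b ↦ ∑_e b_e χ_[pηe] sends (c_j)^{ℓ,η} to a multiple of S_p f_j^{ℓ,η}, so it
    -- carries their span into 𝒲_{q,j}.
    have hmap := Submodule.mem_map_of_mem (f := Fintype.linearCombination ℂ
      (fun e : G.Edge η.left j => G.chi (G.extend (mul p η h) e))) hspan
    rw [Submodule.map_span] at hmap
    refine (Submodule.span_le.2 ?_) hmap
    rintro _ ⟨_, ⟨l, rfl⟩, rfl⟩
    have hS := hG.S_linearCombination p η h (c j η l)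
    rw [← mother_eq, ← inv_smul_eq_iff₀ (hG.sqrt_rhoPow_ne_zero _)] at hS
    rw [Fintype.linearCombination_apply, ← hS]
    exact Submodule.smul_mem _ _ (Submodule.subset_span ⟨p, ⟨η, hη, l⟩, hp, rfl⟩)

/-! ### The orthogonal decompositions -/

section Decomposition

variable [NeZero k]

omit [Nonempty C] in
theorem cylSpan_mono [Nonempty C] : Monotone G.cylSpan :=
  monotone_nat_of_le_succ fun n => hG.cylSpan_le_succ (rainbow_succ n)

theorem detailSpace_isOrtho_of_lt {q q' : ℕ} {j j' : Fin k}
    (h : q * k + (j : ℕ) < q' * k + (j' : ℕ)) :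
    G.detailSpace (q * k + j) j ⟂ G.detailSpace (q' * k + j') j' :=
  ((hG.detail_isOrtho _ j').mono_right ((hG.detailSpace_le (rainbow_mul_add_succ q j)).trans
    (hG.cylSpan_mono h))).symm

theorem refinedW_isOrtho {c : G.CoeffFamily} (hc : G.IsWaveletCoeff c) {q q' : ℕ} {j j' : Fin k}
    (h : q * k + (j : ℕ) ≠ q' * k + (j' : ℕ)) :
    (G.refinedW c q j).IsOrtho (G.refinedW c q' j') := by
  rw [hG.refinedW_eq hc, hG.refinedW_eq hc]
  rcases lt_or_gt_of_ne h with h | h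
  · exact hG.detailSpace_isOrtho_of_lt h
  · exact (hG.detailSpace_isOrtho_of_lt h).symm

theorem V_zero_isOrtho_refinedW {c : G.CoeffFamily} (hc : G.IsWaveletCoeff c) (q : ℕ)
    (j : Fin k) : G.V 0 ⟂ G.refinedW c q j := by
  rw [hG.refinedW_eq hc, ← cylSpan_mul]
  exact ((hG.detail_isOrtho _ j).mono_right (hG.cylSpan_mono (by simp))).symm

theorem cylSpan_le_sup {c : G.CoeffFamily} (hc : G.IsWaveletCoeff c) (q t : ℕ) (ht : t ≤ k) :
    G.cylSpan (q * k + t) ≤ G.V q ⊔ ⨆ j : Fin k, G.refinedW c q j := by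
  induction t with
  | zero =>
    rw [add_zero, cylSpan_mul]
    exact le_sup_left
  | succ t ih =>
    have h := hG.cylSpan_succ_le (rainbow_mul_add_succ q ⟨t, ht⟩)
    refine h.trans (sup_le (ih (Nat.le_of_succ_le ht)) ?_)
    rw [← hG.refinedW_eq hc]
    exact (le_iSup (fun j => G.refinedW c q j) ⟨t, ht⟩).trans le_sup_right

theorem V_succ_le {c : G.CoeffFamily} (hc : G.IsWaveletCoeff c) (q : ℕ) :
    G.V (q + 1) ≤ G.V q ⊔ ⨆ j : Fin k, G.refinedW c q j := by
  have h := hG.cylSpan_le_sup hc q k le_rfl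
  rwa [show q * k + k = (q + 1) * k by ring, cylSpan_mul] at h

theorem refinedW_isOrtho_V {c : G.CoeffFamily} (hc : G.IsWaveletCoeff c) (q : ℕ) (j : Fin k) :
    G.refinedW c q j ⟂ G.V q := by
  rw [hG.refinedW_eq hc, ← cylSpan_mul]
  exact (hG.detail_isOrtho _ j).mono_right (hG.cylSpan_mono (Nat.le_add_right _ _))

theorem refinedW_le_V {c : G.CoeffFamily} (hc : G.IsWaveletCoeff c) (q : ℕ) (j : Fin k) :
    G.refinedW c q j ≤ G.V (q + 1) := by
  rw [hG.refinedW_eq hc, ← cylSpan_mul]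
  refine (hG.detailSpace_le (rainbow_mul_add_succ q j)).trans (hG.cylSpan_mono ?_)
  have := j.2
  rw [add_mul, one_mul]
  omega

theorem W_eq {c : G.CoeffFamily} (hc : G.IsWaveletCoeff c) (q : ℕ) :
    G.W q = ⨆ j : Fin k, G.refinedW c q j := by
  have hortho : (⨆ j : Fin k, G.refinedW c q j) ≤ (G.V q)ᗮ :=
    iSup_le fun j => hG.refinedW_isOrtho_V hc q j
  apply le_antisymm
  · rintro f ⟨hf, hf'⟩
    obtain ⟨v, hv, w, hw, rfl⟩ := Submodule.mem_sup.1 (hG.V_succ_le hc q hf)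
    -- Since f and w are orthogonal to 𝒱_q, so is the component v in 𝒱_q; it therefore vanishes.
    have hv' : v ∈ (G.V q)ᗮ := by
      have := sub_mem hf' (hortho hw)
      rwa [add_sub_cancel_right] at this
    have h0 : v = 0 := by
      rw [← inner_self_eq_zero (𝕜 := ℂ)]
      exact (Submodule.mem_orthogonal _ v).1 hv' v hv
    rwa [h0, zero_add]
  · exact le_inf (iSup_le fun j => hG.refinedW_le_V hc q j) hortho

theorem isHilbertSum {c : G.CoeffFamily} (hc : G.IsWaveletCoeff c) :
    IsHilbertSum ℂ (fun o => G.summand c o) (fun o => (G.summand c o).subtypeₗᵢ) := by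
  have hfd : ∀ o, FiniteDimensional ℂ (G.summand c o) := by
    have hV : ∀ q, FiniteDimensional ℂ (G.V q) := fun q => by
      rw [← cylSpan_mul]
      exact hG.finiteDimensional_cylSpan _
    rintro (_ | ⟨q, j⟩)
    · exact hV 0
    · have := hV (q + 1)
      exact Submodule.finiteDimensional_of_le (hG.refinedW_le_V hc q j)
  have : ∀ o, CompleteSpace (G.summand c o) := fun o => FiniteDimensional.complete ℂ _
  refine IsHilbertSum.mkInternal _ (OrthogonalFamily.of_pairwise ?_) ?_
  · rintro (_ | ⟨q, j⟩) (_ | ⟨q', j'⟩) hne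
    · exact absurd rfl hne
    · exact hG.V_zero_isOrtho_refinedW hc q' j'
    · exact (hG.V_zero_isOrtho_refinedW hc q j).symm
    · refine hG.refinedW_isOrtho hc fun h => hne ?_
      have hq : q = q' := by
        have := congrArg (· / k) h
        have hk : 0 < k := Nat.pos_of_ne_zero (NeZero.ne k)
        simpa [Nat.mul_comm _ k, Nat.mul_add_div hk, Nat.div_eq_of_lt] using this
      subst hq
      obtain rfl : j = j' := Fin.ext (Nat.add_left_cancel h)
      rfl
  · have hle : ∀ q, G.V q ≤ ⨆ o, G.summand c o := by
      intro q
      induction q with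
      | zero => exact le_iSup (fun o => G.summand c o) none
      | succ q ih =>
        exact (hG.V_succ_le hc q).trans (sup_le ih (iSup_le fun j =>
          le_iSup (fun o => G.summand c o) (some (q, j))))
    -- The 𝒱_q are cofinal in the chain: `cylSpan n` lies in `cylSpan (n * k)`, which is 𝒱_n.
    have hle' : ⨆ n, G.cylSpan n ≤ ⨆ o, G.summand c o := iSup_le fun n => by
      refine (hG.cylSpan_mono (Nat.le_mul_of_pos_right n
        (Nat.pos_of_ne_zero (NeZero.ne k)))).trans ?_
      rw [cylSpan_mul]
      exact hle n
    rw [top_le_iff, Submodule.topologicalClosure_eq_top_iff, eq_bot_iff,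
      ← hG.iSup_cylSpan_orthogonal]
    exact Submodule.orthogonal_le hle'

end Decomposition

/-! ### The spaces E_γ -/

section Eigenspaces

variable [NeZero k]

/-- Normalized characteristic functions have integral one, so their differences have integral zero.
Conversely, if ∑_e b_e M[γe] = 0, the normalized function of a fixed edge e₀ can be subtracted in
every term, weighted by b_e M[γe], without changing the sum. -/
theorem eigenspace_eq_detail {δ : ℝ} (hδ : G.dixmierMeasure δ = G.M) (γ : Arrow C) :
    G.eigenspace δ γ = G.detail (Fin.ofNat k (G.length γ)) γ := by
  have := finite_edge hG.finite γ.left (Fin.ofNat k (G.length γ))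
  have := Fintype.ofFinite (G.Edge γ.left (Fin.ofNat k (G.length γ)))
  classical
  rw [eigenspace, hδ]
  simp only [hG.measureReal_cyl]
  apply le_antisymm
  · refine Submodule.span_le.2 ?_
    rintro _ ⟨e, e', hne, rfl⟩
    refine Submodule.subset_span ⟨fun i => (if i = e then (((G.mass (G.extend γ e))⁻¹ : ℝ) : ℂ) else 0)
      - (if i = e' then (((G.mass (G.extend γ e'))⁻¹ : ℝ) : ℂ) else 0), ?_, ?_⟩
    · rw [finsum_eq_sum_of_fintype]
      simp only [sub_mul, Finset.sum_sub_distrib, ite_mul, zero_mul, Finset.sum_ite_eq',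
        Finset.mem_univ, if_true, Complex.ofReal_inv]
      rw [inv_mul_cancel₀ (hG.mass_ne_zero _), inv_mul_cancel₀ (hG.mass_ne_zero _), sub_self]
    · rw [finsum_eq_sum_of_fintype]
      simp only [sub_smul, Finset.sum_sub_distrib, ite_smul, zero_smul, Finset.sum_ite_eq',
        Finset.mem_univ, if_true]
  · refine Submodule.span_le.2 ?_
    rintro _ ⟨b, hb, rfl⟩
    rw [finsum_eq_sum_of_fintype] at hb ⊢
    rcases isEmpty_or_nonempty (G.Edge γ.left (Fin.ofNat k (G.length γ))) with _ | ⟨⟨e₀⟩⟩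
    · rw [Finset.univ_eq_empty, Finset.sum_empty]
      exact zero_mem _
    · have key : ∑ e, b e • G.chi (G.extend γ e)
          = ∑ e, (b e * (G.mass (G.extend γ e) : ℂ)) •
            (((((G.mass (G.extend γ e))⁻¹ : ℝ) : ℂ) • G.chi (G.extend γ e))
              - ((((G.mass (G.extend γ e₀))⁻¹ : ℝ) : ℂ) • G.chi (G.extend γ e₀))) := by
        simp only [smul_sub, Finset.sum_sub_distrib]
        rw [← Finset.sum_smul, hb, zero_smul, sub_zero]
        refine Finset.sum_congr rfl fun e _ => ?_
        rw [smul_smul, Complex.ofReal_inv, _root_.mul_assoc,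
          mul_inv_cancel₀ (hG.mass_ne_zero _), mul_one]
      rw [key]
      refine Submodule.sum_mem _ fun e _ => Submodule.smul_mem _ _ ?_
      by_cases he : e = e₀
      · rw [he, sub_self]
        exact zero_mem _
      · exact Submodule.subset_span ⟨e, e₀, he, rfl⟩

theorem refinedW_eq_iSup_eigenspace {c : G.CoeffFamily} (hc : G.IsWaveletCoeff c) {δ : ℝ}
    (hδ : G.dixmierMeasure δ = G.M) (q : ℕ) (j : Fin k) : G.refinedW c q j =
      ⨆ γ ∈ {γ : Arrow C | G.IsRainbow γ ∧ G.length γ = q * k + (j : ℕ)}, G.eigenspace δ γ := by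
  rw [hG.refinedW_eq hc, detailSpace]
  refine iSup_congr fun γ => ?_
  have hiff : γ ∈ {γ : Arrow C | G.degree γ = rainbow k (q * k + (j : ℕ))} ↔
      γ ∈ {γ : Arrow C | G.IsRainbow γ ∧ G.length γ = q * k + (j : ℕ)} :=
    ⟨fun h => ⟨isRainbow_of_degree_eq h, length_of_degree_eq h⟩, fun h =>
      h.1.trans (congrArg _ h.2)⟩
  refine iSup_congr_Prop hiff fun h => ?_
  rw [hG.eigenspace_eq_detail hδ, h.2, ofNat_mul_add]

end Eigenspaces

end IsRegular

end

end KGraph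

/-! ### Consequences of the diameter hypothesis -/

namespace KGraph

noncomputable section

theorem rainbow_mul_add_general {k : ℕ} [NeZero k] (q m : ℕ) :
    rainbow k (q * k + m) = (fun _ => q) + rainbow k m := by
  have hk : 0 < k := Nat.pos_of_ne_zero (NeZero.ne k)
  funext i
  rw [Pi.add_apply, rainbow, rainbow, Nat.mul_add_mod', Nat.mul_comm q k, Nat.mul_add_div hk,
    add_assoc]

variable {k : ℕ} {C : Type u} [SmallCategory C] [Fintype C] [DecidableEq C] {G : KGraph k C}

omit [Fintype C] [DecidableEq C] in
theorem exists_rainbow_separating [NeZero k] (F : Finset G.InfPath) :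
    ∃ n, ∀ x ∈ F, ∀ y ∈ F, G.seg x (rainbow k n) = G.seg y (rainbow k n) → x = y := by
  have hmono : ∀ (x y : G.InfPath) {m n : Fin k → ℕ}, m ≤ n → G.seg x n = G.seg y n →
      G.seg x m = G.seg y m := fun x y m n h e =>
    (seg_isPrefix x h).eq_of_degree_eq (G := G) (e ▸ seg_isPrefix y h) (by
      rw [degree_seg, degree_seg])
  have h : ∀ p : G.InfPath × G.InfPath, ∃ n,
      G.seg p.1 (rainbow k n) = G.seg p.2 (rainbow k n) → p.1 = p.2 := by
    rintro ⟨x, y⟩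
    by_contra! hne
    exact (hne 0).2 (ext_seg fun n => hmono x y (le_rainbow_sum_mul n) (hne _).1)
  choose N hN using h
  refine ⟨(F ×ˢ F).sup N, fun x hx y hy e => hN (x, y) (hmono x y (rainbow_mono ?_) e)⟩
  exact Finset.le_sup (f := N) (Finset.mk_mem_product hx hy)

theorem rhoPow_const (q : ℕ) : G.rhoPow (fun _ => q) = G.rhoPow 1 ^ q := by
  simp [rhoPow, Finset.prod_pow]

namespace IsRegular

variable [Nonempty C] (hG : G.IsRegular)
include hG

theorem rhoPow_pos (n : Fin k → ℕ) : 0 < G.rhoPow n :=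
  KGraph.rhoPow_pos hG.finite hG.noSources hG.perronFrobenius n

theorem mass_pos (p : Arrow C) : 0 < G.mass p :=
  KGraph.mass_pos hG.finite hG.noSources hG.perronFrobenius p

theorem rhoPow_mono {m n : Fin k → ℕ} (h : m ≤ n) : G.rhoPow m ≤ G.rhoPow n := by
  rw [← add_tsub_cancel_of_le h, rhoPow_add]
  exact le_mul_of_one_le_right (hG.rhoPow_pos m).le
    (one_le_rhoPow hG.finite hG.noSources hG.perronFrobenius _)

omit [Nonempty C] in
theorem exists_pfVector_lower_bound : ∃ c, 0 < c ∧ ∀ v, c ≤ G.pfVector v := by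
  rcases isEmpty_or_nonempty C with _ | _
  · exact ⟨1, one_pos, fun v => isEmptyElim v⟩
  · obtain ⟨v, -, hv⟩ := Finset.exists_min_image Finset.univ G.pfVector Finset.univ_nonempty
    exact ⟨_, hG.perronFrobenius.1 v, fun w => hv w (Finset.mem_univ w)⟩

theorem weight_pos (δ : ℝ) (p : Arrow C) : 0 < G.weight δ p :=
  mul_pos (Real.rpow_pos_of_pos (hG.rhoPow_pos _) _) (hG.perronFrobenius.1 _)

omit [Nonempty C] in
theorem sum_mass_le_one (F : Finset (Arrow C)) (n : Fin k → ℕ) (hF : ∀ p ∈ F, G.degree p = n) :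
    ∑ p ∈ F, ENNReal.ofReal (G.mass p) ≤ 1 := by
  have := hG.pathMeasure.1
  rw [← Finset.sum_congr rfl fun p _ => measure_cyl hG.pathMeasure p,
    ← measure_biUnion_finset (fun p hp q hq h => disjoint_cyl ((hF p hp).trans (hF q hq).symm) h)
      fun p _ => G.measurableSet_cyl p]
  exact prob_le_one

/-- If the cylinder sets have the right diameters, then `ρ_1 ⋯ ρ_k > 1`. -/
theorem one_lt_rhoPow_one [NeZero k] {δ : ℝ} (hw : G.WeightEqDiam δ) : 1 < G.rhoPow 1 := by
  classical
  by_contra! hle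
  have h1 : ∀ n, G.rhoPow n = 1 := fun n => by
    refine le_antisymm ?_ (one_le_rhoPow hG.finite hG.noSources hG.perronFrobenius n)
    refine (hG.rhoPow_mono (le_rainbow_sum_mul n)).trans ?_
    rw [rainbow_mul, rhoPow_const]
    exact pow_le_one₀ (hG.rhoPow_pos 1).le hle
  obtain ⟨c, hc, hcle⟩ := hG.exists_pfVector_lower_bound
  -- With all powers of ρ equal to 1, each cylinder has mass at least c. Since the total mass is 1,
  -- at most 1/c paths can be separated at a finite level.
  have hfinite : Finite G.InfPath := by
    by_contra hinf
    rw [not_finite_iff_infinite] at hinf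
    obtain ⟨N, hN⟩ := exists_nat_gt (1 / c)
    obtain ⟨F, hF⟩ := Infinite.exists_subset_card_eq G.InfPath N
    obtain ⟨n, hn⟩ := exists_rainbow_separating F
    have hinj : Set.InjOn (fun x => G.seg x (rainbow k n)) F := fun x hx y hy e => hn x hx y hy e
    have hsum := hG.sum_mass_le_one (F.image fun x => G.seg x (rainbow k n)) (rainbow k n) (by
      intro p hp
      obtain ⟨x, -, rfl⟩ := Finset.mem_image.1 hp
      exact degree_seg x _)
    rw [← ENNReal.ofReal_sum_of_nonneg fun p _ => (hG.mass_pos p).le, ENNReal.ofReal_le_one] at hsum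
    have hlow : (N : ℝ) * c ≤ 1 := by
      refine le_trans ?_ hsum
      rw [← hF, ← Finset.card_image_of_injOn hinj, ← nsmul_eq_mul]
      refine Finset.card_nsmul_le_sum _ _ _ fun p _ => ?_
      rw [mass, h1, inv_one, one_mul]
      exact hcle _
    rw [div_lt_iff₀ hc] at hN
    linarith
  have := Fintype.ofFinite G.InfPath
  -- Finitely many paths are separated at one level n. Cylinders of that level are singletons of
  -- diameter 0, whereas weights are positive.
  obtain ⟨n, hn⟩ := exists_rainbow_separating (Finset.univ : Finset G.InfPath)
  obtain ⟨v⟩ := ‹Nonempty C›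
  obtain ⟨x, -⟩ := cyl_nonempty hG.noSources (vertex v)
  have hγ : G.IsRainbow (G.seg x (rainbow k n)) := isRainbow_of_degree_eq (degree_seg x _)
  have hlub := hw _ hγ
  have hset : {t : ℝ | ∃ y ∈ G.cyl (G.seg x (rainbow k n)), ∃ z ∈ G.cyl (G.seg x (rainbow k n)),
      t = G.ultraDist δ y z} ⊆ {0} := by
    rintro _ ⟨y, hy, z, hz, rfl⟩
    rw [mem_cyl, degree_seg] at hy hz
    obtain rfl := hn y (Finset.mem_univ _) z (Finset.mem_univ _) (hy.trans hz.symm)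
    simp [ultraDist]
  have := hlub.2 (fun t ht => le_of_eq (hset ht))
  exact (hG.weight_pos δ _).not_ge this

end IsRegular

end

end KGraph

/-! ### The zeta function and its partial sums -/

namespace KGraph

noncomputable section

variable {k : ℕ} {C : Type u} [SmallCategory C] [Fintype C] [DecidableEq C] {G : KGraph k C}

/-- The sum `∑_{p ∈ F_γ ℬ_Λ} w_δ(p)^s`. -/
def partialZeta (G : KGraph k C) (δ s : ℝ) (γ : Arrow C) : ℝ≥0∞ :=
  ∑' p : G.FBExt γ, ENNReal.ofReal (G.weight δ p.1 ^ s)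

omit [Fintype C] [DecidableEq C] in
theorem mem_FBExt {γ p : Arrow C} : p ∈ G.FBExt γ ↔ G.IsRainbow p ∧ IsPrefix γ p := Iff.rfl

omit [Fintype C] [DecidableEq C] in
theorem mem_FBExt_vertex {v : C} {p : Arrow C} :
    p ∈ G.FBExt (vertex v) ↔ G.IsRainbow p ∧ p.right = v := by
  rw [mem_FBExt]
  refine and_congr_right fun _ => ⟨fun h => h.right_eq.symm, fun h => ⟨p, h.symm, vertex_mul _ _ _⟩⟩

theorem zeta_eq_sum_partialZeta (δ s : ℝ) :
    G.zeta δ s = ∑ v, G.partialZeta δ s (vertex v) := by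
  classical
  simp only [zeta, partialZeta]
  rw [tsum_subtype G.FB fun p => ENNReal.ofReal (G.weight δ p ^ s)]
  simp only [tsum_subtype (G.FBExt _) fun p => ENNReal.ofReal (G.weight δ p ^ s)]
  rw [← Summable.tsum_finsetSum fun _ _ => ENNReal.summable]
  refine tsum_congr fun p => ?_
  by_cases hp : G.IsRainbow p
  · rw [Set.indicator_of_mem (show p ∈ G.FB from hp), Finset.sum_eq_single p.right,
      Set.indicator_of_mem (mem_FBExt_vertex.2 ⟨hp, rfl⟩)]
    · intro v _ hv
      exact Set.indicator_of_notMem (fun h => hv (mem_FBExt_vertex.1 h).2.symm) _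
    · simp
  · rw [Set.indicator_of_notMem (show p ∉ G.FB from hp)]
    exact (Finset.sum_eq_zero fun v _ => Set.indicator_of_notMem (fun h => hp h.1) _).symm

omit [Fintype C] [DecidableEq C] in
theorem IsFinite.finite_degree (hfin : G.IsFinite) (n : Fin k → ℕ) :
    {p : Arrow C | G.degree p = n}.Finite := hfin n

theorem zeta_eq_tsum_degree [NeZero k] (hfin : G.IsFinite) (δ s : ℝ) :
    G.zeta δ s = ∑' n, ∑ p ∈ (hfin.finite_degree (rainbow k n)).toFinset,
      ENNReal.ofReal (G.weight δ p ^ s) := by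
  have h : ∀ n, ∑ p ∈ (hfin.finite_degree (rainbow k n)).toFinset,
      ENNReal.ofReal (G.weight δ p ^ s) = ∑' p, Set.indicator {q | G.degree q = rainbow k n}
        (fun p => ENNReal.ofReal (G.weight δ p ^ s)) p := fun n => by
    rw [sum_eq_tsum_indicator, Set.Finite.coe_toFinset]
  rw [tsum_congr h, zeta, tsum_subtype G.FB fun p => ENNReal.ofReal (G.weight δ p ^ s),
    ENNReal.tsum_comm]
  refine tsum_congr fun p => ?_
  by_cases hp : G.IsRainbow p
  · have h1 : ∀ n ≠ G.length p, Set.indicator {q | G.degree q = rainbow k n}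
        (fun p => ENNReal.ofReal (G.weight δ p ^ s)) p = 0 := fun n hn =>
      Set.indicator_of_notMem (s := {q | G.degree q = rainbow k n})
        (fun h => hn (length_of_degree_eq h).symm) _
    rw [Set.indicator_of_mem (show p ∈ G.FB from hp), tsum_eq_single (G.length p) h1,
      Set.indicator_of_mem (show p ∈ {q | G.degree q = rainbow k (G.length p)} from hp)]
  · rw [Set.indicator_of_notMem (show p ∉ G.FB from hp)]
    refine (ENNReal.tsum_eq_zero.2 fun n => ?_).symm
    exact Set.indicator_of_notMem (s := {q | G.degree q = rainbow k n})
      (fun h => hp (isRainbow_of_degree_eq h)) _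

/-- A Bratteli path extending γ is γ itself or extends exactly one γe, whose color is forced by the
length of γ. -/
theorem partialZeta_eq_add [NeZero k] (δ s : ℝ) {γ : Arrow C} {n : ℕ}
    {j : Fin k} (hγ : G.degree γ = rainbow k n)
    (hn : rainbow k (n + 1) = rainbow k n + Pi.single j 1) [Fintype (G.Edge γ.left j)] :
    G.partialZeta δ s γ = ENNReal.ofReal (G.weight δ γ ^ s)
      + ∑ e : G.Edge γ.left j, G.partialZeta δ s (G.extend γ e) := by
  classical
  simp only [partialZeta]
  simp only [tsum_subtype (G.FBExt _) fun p => ENNReal.ofReal (G.weight δ p ^ s)]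
  have h1 : ENNReal.ofReal (G.weight δ γ ^ s)
      = ∑' p, Set.indicator {γ} (fun p => ENNReal.ofReal (G.weight δ p ^ s)) p := by
    have h := tsum_eq_single (L := SummationFilter.unconditional _)
      (f := Set.indicator {γ} fun p => ENNReal.ofReal (G.weight δ p ^ s)) γ
      fun p hp => Set.indicator_of_notMem (s := {γ}) hp _
    exact (h.trans (Set.indicator_of_mem (Set.mem_singleton γ) _)).symm
  rw [h1, ← Summable.tsum_finsetSum fun _ _ => ENNReal.summable, ← ENNReal.tsum_add]
  refine tsum_congr fun p => ?_
  have hne : ∀ e : G.Edge γ.left j, ¬ IsPrefix (G.extend γ e) γ := fun e h => by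
    have := h.degree_le (G := G) j
    rw [degree_extend] at this
    simp at this
  by_cases hp : p ∈ G.FBExt γ
  · obtain ⟨hr, hpre⟩ := mem_FBExt.1 hp
    rw [Set.indicator_of_mem hp]
    by_cases hpγ : p = γ
    · subst hpγ
      rw [Set.indicator_of_mem (Set.mem_singleton p), Finset.sum_eq_zero, add_zero]
      exact fun e _ => Set.indicator_of_notMem (fun h => hne e h.2) _
    · rw [Set.indicator_of_notMem (show p ∉ ({γ} : Set _) from hpγ), zero_add]
      have hlt : n < G.length p := by
        by_contra! hle
        refine hpγ ?_
        have h2 : G.degree p ≤ G.degree γ := by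
          rw [hr, hγ]
          exact rainbow_mono hle
        exact (IsPrefix.refl p).eq_of_degree_eq (G := G) hpre
          (le_antisymm h2 (hpre.degree_le (G := G)))
      have hle : rainbow k n + Pi.single j 1 ≤ G.degree p := by
        rw [← hn, hr]
        exact rainbow_mono hlt
      obtain ⟨a, ha, hda⟩ := exists_isPrefix_degree (G := G) hle
      obtain ⟨r, hγr, rfl⟩ := hpre.of_degree_le (G := G) ha (by
        rw [hda, hγ]
        exact le_self_add)
      rw [degree_mul, hγ] at hda
      let e₀ : G.Edge γ.left j := ⟨r, hγr.symm, add_left_cancel hda⟩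
      rw [Finset.sum_eq_single e₀, Set.indicator_of_mem (show p ∈ G.FBExt (G.extend γ e₀) from
        ⟨hr, ha⟩)]
      · intro e _ he
        refine Set.indicator_of_notMem (fun h => he ?_) _
        refine extend_injective γ ((mem_FBExt.1 h).2.eq_of_degree_eq (G := G) ha
        ((degree_extend γ e).trans (degree_extend γ e₀).symm))
      · simp
  · have hpγ : p ≠ γ := by
      rintro rfl
      exact hp ⟨isRainbow_of_degree_eq hγ, IsPrefix.refl p⟩
    rw [Set.indicator_of_notMem hp, Set.indicator_of_notMem (show p ∉ ({γ} : Set _) from hpγ),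
      zero_add, Finset.sum_eq_zero]
    exact fun e _ => Set.indicator_of_notMem
      (fun h => hp ⟨h.1, (isPrefix_extend γ e).trans (mem_FBExt.1 h).2⟩) _

namespace IsRegular

variable [Nonempty C] (hG : G.IsRegular)
include hG

/-- The colors have period k, so prefixing a path of degree (q,…,q) preserves the shape of Bratteli
paths. It maps those with range s(γ) bijectively onto the extensions of γ and scales each weight by
ρ(Λ)^{-d(γ)/δ}. -/
theorem partialZeta_diagonal [NeZero k] (δ s : ℝ) {γ : Arrow C} {q : ℕ}
    (hγ : G.degree γ = fun _ => q) : G.partialZeta δ s γ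
      = ENNReal.ofReal ((G.rhoPow (G.degree γ) ^ (-1 / δ)) ^ s)
        * G.partialZeta δ s (vertex γ.left) := by
  have hmul : ∀ (r : Arrow C) (h : γ.left = r.right), G.IsRainbow (mul γ r h) ↔ G.IsRainbow r := by
    intro r h
    have hlen : G.length (mul γ r h) = q * k + G.length r := by
      simp only [length, degree_mul, hγ, Pi.add_apply, Finset.sum_add_distrib]
      simp [mul_comm]
    rw [IsRainbow, IsRainbow, hlen, rainbow_mul_add_general, degree_mul, hγ]
    exact add_right_inj _
  let φ : G.FBExt (vertex γ.left) → G.FBExt γ := fun r =>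
    ⟨mul γ r.1 (mem_FBExt_vertex.1 r.2).2.symm, (hmul _ _).2 r.2.1, isPrefix_mul _ _ _⟩
  have hφ : Function.Bijective φ := by
    constructor
    · intro r r' h
      exact Subtype.ext (mul_inj (G := G) (h := (mem_FBExt_vertex.1 r.2).2.symm)
        (h' := (mem_FBExt_vertex.1 r'.2).2.symm) (congrArg Subtype.val h) rfl).2
    · rintro ⟨p, hp, r, h, rfl⟩
      exact ⟨⟨r, mem_FBExt_vertex.2 ⟨(hmul r h).1 hp, h.symm⟩⟩, rfl⟩
  rw [partialZeta, partialZeta, ← (Equiv.ofBijective φ hφ).tsum_eq, ← ENNReal.tsum_mul_left]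
  refine tsum_congr fun r => ?_
  rw [← ENNReal.ofReal_mul (Real.rpow_nonneg (Real.rpow_nonneg (hG.rhoPow_pos _).le _) _)]
  refine congrArg ENNReal.ofReal ?_
  change G.weight δ (mul γ r.1 (mem_FBExt_vertex.1 r.2).2.symm) ^ s = _
  rw [weight, degree_mul, rhoPow_add, Real.mul_rpow (hG.rhoPow_pos _).le (hG.rhoPow_pos _).le,
    _root_.mul_assoc, ← Real.mul_rpow (Real.rpow_nonneg (hG.rhoPow_pos _).le _)
      (hG.weight_pos δ r.1).le]
  rfl

omit [Nonempty C] in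
theorem sum_mass_degree (n : Fin k → ℕ) :
    ∑ p ∈ (hG.finite.finite_degree n).toFinset, ENNReal.ofReal (G.mass p) = 1 := by
  have := hG.pathMeasure.1
  rw [← Finset.sum_congr rfl fun p _ => measure_cyl hG.pathMeasure p,
    ← measure_biUnion_finset (fun p hp q hq h => disjoint_cyl
      (((hG.finite.finite_degree n).mem_toFinset.1 hp).trans ((hG.finite.finite_degree n).mem_toFinset.1 hq).symm) h)
      fun p _ => G.measurableSet_cyl p]
  simp only [Set.Finite.mem_toFinset]
  rw [biUnion_cyl_eq_univ]
  exact measure_univ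

/-- With c a lower bound for x^Λ and a = (ρ_1⋯ρ_k)^{1-s/δ} < 1, each term at level n is at most M[p]
c⁻¹ a^⌊n/k⌋. The masses at one level sum to 1, which leaves a geometric series with every term
repeated k times. -/
theorem zeta_lt_top [NeZero k] (hρ : 1 < G.rhoPow 1) {δ s : ℝ} (hδ : 0 < δ) (hs : δ < s) :
    G.zeta δ s < ∞ := by
  have hk : 0 < k := Nat.pos_of_ne_zero (NeZero.ne k)
  obtain ⟨c, hc, hcle⟩ := hG.exists_pfVector_lower_bound
  have hexp : 1 - s / δ < 0 := sub_neg.2 ((one_lt_div hδ).2 hs)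
  set a : ℝ := G.rhoPow 1 ^ (1 - s / δ) with ha
  have ha0 : 0 ≤ a := Real.rpow_nonneg (hG.rhoPow_pos 1).le _
  have ha1 : a < 1 := Real.rpow_lt_one_of_one_lt_of_neg hρ hexp
  have hbound : ∀ (n : ℕ) (p : Arrow C), G.degree p = rainbow k n →
      ENNReal.ofReal (G.weight δ p ^ s)
        ≤ ENNReal.ofReal (G.mass p) * ENNReal.ofReal (c⁻¹ * a ^ (n / k)) := by
    intro n p hp
    rw [← ENNReal.ofReal_mul (hG.mass_pos p).le]
    refine ENNReal.ofReal_le_ofReal ?_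
    have hR := hG.rhoPow_pos (G.degree p)
    have hx := hG.perronFrobenius.1 p.left
    have hx1 := pfVector_le_one hG.perronFrobenius p.left
    have h1 : G.weight δ p ^ s ≤ G.rhoPow (G.degree p) ^ (-s / δ) := by
      rw [weight, Real.mul_rpow (Real.rpow_nonneg hR.le _) hx.le, ← Real.rpow_mul hR.le]
      have : -1 / δ * s = -s / δ := by ring
      rw [this]
      exact mul_le_of_le_one_right (Real.rpow_nonneg hR.le _)
        (Real.rpow_le_one hx.le hx1 (hδ.trans hs).le)
    have h2 : G.rhoPow (G.degree p) ^ (-s / δ)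
        = (G.rhoPow (G.degree p))⁻¹ * G.rhoPow (G.degree p) ^ (1 - s / δ) := by
      rw [← Real.rpow_neg_one, ← Real.rpow_add hR]
      congr 1
      ring
    have h3 : G.rhoPow (G.degree p) ^ (1 - s / δ) ≤ a ^ (n / k) := by
      have hle : G.rhoPow 1 ^ (n / k) ≤ G.rhoPow (G.degree p) := by
        rw [← rhoPow_const, ← rainbow_mul, hp]
        exact hG.rhoPow_mono (rainbow_mono (Nat.div_mul_le_self n k))
      rw [ha, ← Real.rpow_natCast, ← Real.rpow_mul (hG.rhoPow_pos 1).le, mul_comm,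
        Real.rpow_mul (hG.rhoPow_pos 1).le, Real.rpow_natCast]
      exact Real.rpow_le_rpow_of_nonpos (pow_pos (hG.rhoPow_pos 1) _) hle hexp.le
    have h4 : 1 ≤ G.pfVector p.left * c⁻¹ := by
      rw [← div_eq_mul_inv]
      exact (one_le_div hc).2 (hcle _)
    calc G.weight δ p ^ s
        ≤ (G.rhoPow (G.degree p))⁻¹ * a ^ (n / k) := by
          rw [h2] at h1
          exact h1.trans (mul_le_mul_of_nonneg_left h3 (inv_pos.2 hR).le)
      _ ≤ (G.rhoPow (G.degree p))⁻¹ * a ^ (n / k) * (G.pfVector p.left * c⁻¹) :=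
          le_mul_of_one_le_right (mul_nonneg (inv_pos.2 hR).le (pow_nonneg ha0 _)) h4
      _ = G.mass p * (c⁻¹ * a ^ (n / k)) := by
          rw [mass]
          ring
  have hsum : Summable fun q : ℕ × Fin k => c⁻¹ * a ^ q.1 := by
    have h := (summable_geometric_of_lt_one ha0 ha1).mul_left c⁻¹
    exact (summable_prod_of_nonneg fun q => mul_nonneg (inv_pos.2 hc).le (pow_nonneg ha0 _)).2
      ⟨fun q => (hasSum_fintype _).summable, by
        simpa [tsum_fintype] using h.mul_left (k : ℝ)⟩
  have hsum' : Summable fun n : ℕ => c⁻¹ * a ^ (n / k) :=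
    (Nat.divModEquiv k).summable_iff.2 hsum
  rw [zeta_eq_tsum_degree hG.finite]
  refine lt_of_le_of_lt (ENNReal.tsum_le_tsum fun n => ?_) hsum'.tsum_ofReal_lt_top
  calc ∑ p ∈ (hG.finite.finite_degree (rainbow k n)).toFinset, ENNReal.ofReal (G.weight δ p ^ s)
      ≤ ∑ p ∈ (hG.finite.finite_degree (rainbow k n)).toFinset,
          ENNReal.ofReal (G.mass p) * ENNReal.ofReal (c⁻¹ * a ^ (n / k)) :=
        Finset.sum_le_sum fun p hp => hbound n p ((hG.finite.finite_degree _).mem_toFinset.1 hp)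
    _ = ENNReal.ofReal (c⁻¹ * a ^ (n / k)) := by
        rw [← Finset.sum_mul, hG.sum_mass_degree, one_mul]

/-- At s = δ each level contributes at least 1: since x^Λ ≤ 1 and δ < 1, w_δ(p)^δ = ρ(Λ)^{-d(p)}
(x^Λ_{s(p)})^δ is at least M[p]. Finitely many levels depend continuously on s, so N + 1 of them
push the sum above N near δ. -/
theorem tendsto_zeta [NeZero k] {δ : ℝ} (hδ : 0 < δ) (hδ1 : δ < 1) :
    Tendsto (G.zeta δ) (𝓝[>] δ) (𝓝 ∞) := by
  refine ENNReal.tendsto_nhds_top fun N => ?_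
  have hcont : Tendsto (fun s => ∑ n ∈ Finset.range (N + 1),
      ∑ p ∈ (hG.finite.finite_degree (rainbow k n)).toFinset, ENNReal.ofReal (G.weight δ p ^ s)) (𝓝[>] δ)
      (𝓝 (∑ n ∈ Finset.range (N + 1),
        ∑ p ∈ (hG.finite.finite_degree (rainbow k n)).toFinset, ENNReal.ofReal (G.weight δ p ^ δ))) := by
    refine tendsto_finsetSum _ fun n _ => tendsto_finsetSum _ fun p _ => ?_
    refine (ENNReal.continuous_ofReal.tendsto _).comp ?_
    exact ((Real.continuous_const_rpow (hG.weight_pos δ p).ne').tendsto δ).mono_left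
      nhdsWithin_le_nhds
  have hlow : ((N + 1 : ℕ) : ℝ≥0∞) ≤ ∑ n ∈ Finset.range (N + 1),
      ∑ p ∈ (hG.finite.finite_degree (rainbow k n)).toFinset, ENNReal.ofReal (G.weight δ p ^ δ) := by
    have h : ∀ n ∈ Finset.range (N + 1), (1 : ℝ≥0∞)
        ≤ ∑ p ∈ (hG.finite.finite_degree (rainbow k n)).toFinset, ENNReal.ofReal (G.weight δ p ^ δ) := by
      intro n _
      rw [← hG.sum_mass_degree (rainbow k n)]
      refine Finset.sum_le_sum fun p _ => ENNReal.ofReal_le_ofReal ?_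
      have hR := hG.rhoPow_pos (G.degree p)
      have hx := hG.perronFrobenius.1 p.left
      rw [weight, mass, Real.mul_rpow (Real.rpow_nonneg hR.le _) hx.le, ← Real.rpow_mul hR.le,
        div_mul_cancel₀ _ hδ.ne', Real.rpow_neg_one]
      refine mul_le_mul_of_nonneg_left ?_ (inv_pos.2 hR).le
      conv_lhs => rw [← Real.rpow_one (G.pfVector p.left)]
      exact Real.rpow_le_rpow_of_exponent_ge hx (pfVector_le_one hG.perronFrobenius _) hδ1.le
    simpa using Finset.card_nsmul_le_sum _ _ _ h
  have hlt : (N : ℝ≥0∞) < ((N + 1 : ℕ) : ℝ≥0∞) := by exact_mod_cast N.lt_succ_self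
  filter_upwards [hcont.eventually_const_lt (hlt.trans_le hlow)] with s hs
  refine hs.trans_le ?_
  rw [zeta_eq_tsum_degree hG.finite]
  exact ENNReal.sum_le_tsum _

end IsRegular

end

end KGraph

/-! ### Identification of the Dixmier measure with `M` -/

namespace KGraph

noncomputable section

section Paths

variable {k : ℕ} {C : Type u} [SmallCategory C] {G : KGraph k C}

theorem sum_pathsTo_add {R : Type*} [AddCommMonoid R] [∀ v n, Fintype (G.PathsTo v n)] (v : C)
    (m n : Fin k → ℕ) (F : Arrow C → R) :
    ∑ p : G.PathsTo v (m + n), F p.1 = ∑ r : G.PathsTo v m, ∑ e : G.PathsTo r.1.left n,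
      F (mul r.1 e.1 e.2.1.symm) := by
  rw [Finset.sum_sigma']
  symm
  let φ : (Σ r : G.PathsTo v m, G.PathsTo r.1.left n) → G.PathsTo v (m + n) := fun p =>
    ⟨mul p.1.1 p.2.1 p.2.2.1.symm, p.1.2.1, by rw [degree_mul, p.1.2.2, p.2.2.2]⟩
  refine Fintype.sum_bijective φ ⟨?_, ?_⟩ _ _ fun _ => rfl
  · rintro ⟨⟨r, hr⟩, e, he⟩ ⟨⟨r', hr'⟩, e', he'⟩ h
    obtain ⟨rfl, rfl⟩ := mul_inj (G := G) (h := he.1.symm) (h' := he'.1.symm)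
      (congrArg Subtype.val h) (hr.2.trans hr'.2.symm)
    rfl
  · rintro ⟨p, hp, hd⟩
    obtain ⟨r, e, h, hr, he, rfl⟩ := exists_mul_eq (G := G) hd
    exact ⟨⟨⟨r, hp, hr⟩, ⟨e, h.symm, he⟩⟩, rfl⟩

end Paths

variable {k : ℕ} {C : Type u} [SmallCategory C] [Fintype C] [DecidableEq C] {G : KGraph k C}

namespace IsRegular

variable [Nonempty C] (hG : G.IsRegular)
include hG

/-- The function `p ↦ M [p]` on the finite paths of the Bratteli diagram is determined by its
additivity and its behavior under multiplication by diagonal paths. -/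
theorem eq_mass [NeZero k] [∀ v n, Fintype (G.PathsTo v n)]
    (hirr : ((G.adjDeg 1).map (Nat.cast : ℕ → ℝ)).IsIrreducible) {m : Arrow C → ℝ≥0∞}
    (hadd : ∀ (γ : Arrow C) (n : ℕ), G.degree γ = rainbow k n →
      m γ = ∑ e : G.PathsTo γ.left (Pi.single (Fin.ofNat k n) 1), m (mul γ e.1 e.2.1.symm))
    (hdiag : ∀ (γ : Arrow C) (q : ℕ), (G.degree γ = fun _ => q) →
      m γ = ENNReal.ofReal (G.rhoPow (G.degree γ))⁻¹ * m (vertex γ.left))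
    (hone : ∑ v, m (vertex v) = 1) {γ : Arrow C} (hγ : G.IsRainbow γ) :
    m γ = ENNReal.ofReal (G.mass γ) := by
  have hne : ∀ v, m (vertex v) ≠ ∞ := fun v => by
    refine ne_top_of_le_ne_top ENNReal.one_ne_top ?_
    rw [← hone]
    exact Finset.single_le_sum (f := fun v => m (vertex v)) (fun _ _ => zero_le)
      (Finset.mem_univ v)
  have hiter : ∀ (v : C) (n : ℕ), m (vertex v) = ∑ p : G.PathsTo v (rainbow k n), m p.1 := by
    intro v n
    induction n with
    | zero =>
      rw [rainbow_zero]
      symm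
      let v₀ : G.PathsTo v 0 := ⟨vertex v, rfl, degree_vertex G v⟩
      refine Fintype.sum_eq_single v₀ ?_
      intro p hp
      refine absurd (Subtype.ext ?_) hp
      have h := eq_vertex_of_degree_eq_zero p.2.2
      have h1 : p.1.left = v := (congrArg Arrow.right h).symm.trans p.2.1
      exact h.trans (congrArg vertex h1)
    | succ n ih =>
      rw [ih, rainbow_succ, sum_pathsTo_add v _ _ m]
      exact Finset.sum_congr rfl fun p _ => hadd p.1 n p.2.2
  -- Additivity over one full period, combined with the scaling at diagonal paths, gives the
  -- eigenvector equation for A_1⋯A_k at the vertices.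
  have hstep : ∀ v, G.rhoPow 1 * (m (vertex v)).toReal
      = ∑ w, (G.adjDeg 1 v w : ℝ) * (m (vertex w)).toReal := by
    intro v
    have h1 : rainbow k (1 * k) = 1 := rainbow_mul 1
    have h := hiter v (1 * k)
    rw [h1, Finset.sum_congr rfl fun p _ => hdiag p.1 1 p.2.2] at h
    simp only [fun p : G.PathsTo v 1 => p.2.2] at h
    rw [← Finset.mul_sum, sum_pathsTo hG.finite v 1 fun w => m (vertex w)] at h
    have h2 := congrArg ENNReal.toReal h
    rw [ENNReal.toReal_mul, ENNReal.toReal_ofReal (inv_pos.2 (hG.rhoPow_pos 1)).le,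
      ENNReal.toReal_sum fun w _ => ENNReal.mul_ne_top (ENNReal.natCast_ne_top _) (hne w)] at h2
    rw [h2, mul_inv_cancel_left₀ (hG.rhoPow_pos 1).ne']
    simp
  have hvertex : ∀ v, m (vertex v) = ENNReal.ofReal (G.pfVector v) := by
    obtain ⟨c, hc⟩ := Matrix.eigenvector_unique hirr.nonneg
      (fun i j => ((Matrix.isIrreducible_iff_exists_pow_pos hirr.nonneg).1 hirr i j).imp
        fun _ h => h.2) hG.perronFrobenius.1
      (adjDeg_mulVec_pfVector hG.finite hG.perronFrobenius 1)
      (y := fun v => (m (vertex v)).toReal) (funext fun v => (hstep v).symm)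
    have hsum := congrArg ENNReal.toReal hone
    rw [ENNReal.toReal_sum fun v _ => hne v, ENNReal.toReal_one] at hsum
    have hc1 : c = 1 := by
      rw [← hsum, ← mul_one c, ← hG.perronFrobenius.2.1, Finset.mul_sum]
      exact Finset.sum_congr rfl fun v _ => (congrFun hc v).symm
    intro v
    rw [← ENNReal.ofReal_toReal (hne v)]
    refine congrArg _ ((congrFun hc v).trans ?_)
    rw [hc1, one_smul]
  -- At lengths qk the value is given by the diagonal rule. Additivity then passes it down from
  -- length n + 1 to n; t counts the steps left to the next chosen multiple of k.
  have hdown : ∀ (t n q : ℕ) (γ : Arrow C), n + t = q * k → G.degree γ = rainbow k n →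
      m γ = ENNReal.ofReal (G.mass γ) := by
    intro t
    induction t with
    | zero =>
      intro n q γ hn hd
      rw [add_zero] at hn
      rw [hn, rainbow_mul] at hd
      rw [hdiag γ q hd, hvertex, mass, ENNReal.ofReal_mul (inv_pos.2 (hG.rhoPow_pos _)).le]
    | succ t ih =>
      intro n q γ hn hd
      rw [hadd γ n hd, ← sum_mass hG.finite hG.noSources hG.perronFrobenius γ
        (Pi.single (Fin.ofNat k n) 1), ENNReal.ofReal_sum_of_nonneg fun _ _ => (hG.mass_pos _).le]
      refine Finset.sum_congr rfl fun e _ => ih (n + 1) q _ (by omega) ?_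
      rw [degree_mul, hd, e.2.2, rainbow_succ]
  have hle : G.length γ ≤ G.length γ * k :=
    Nat.le_mul_of_pos_right _ (Nat.pos_of_ne_zero (NeZero.ne k))
  exact hdown (G.length γ * k - G.length γ) _ (G.length γ) γ (Nat.add_sub_cancel' hle) hγ

/-- The limits that define the measure induced by the Dixmier trace. -/
theorem tendsto_partialZeta_div_zeta [NeZero k]
    (hirr : ((G.adjDeg 1).map (Nat.cast : ℕ → ℝ)).IsIrreducible) (hρ : 1 < G.rhoPow 1) {δ : ℝ}
    (hδ : 0 < δ) (hδ1 : δ < 1) {γ : Arrow C} (hγ : G.IsRainbow γ) :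
    Tendsto (fun s : ℝ => G.partialZeta δ s γ / G.zeta δ s) (𝓝[>] δ)
      (𝓝 (ENNReal.ofReal (G.mass γ))) := by
  have := fun v n => hG.finite.finite_pathsTo v n
  have := fun v n => Fintype.ofFinite (G.PathsTo v n)
  -- Along an ultrafilter all the quotients converge in [0,∞], and the algebraic relations among
  -- them determine the limit. Convergence along the original filter follows.
  refine (tendsto_iff_ultrafilter _ _ _).2 fun F hF => ?_
  set m : Arrow C → ℝ≥0∞ := fun γ => (F.map fun s => G.partialZeta δ s γ / G.zeta δ s).lim
  have hm : ∀ γ, Tendsto (fun s : ℝ => G.partialZeta δ s γ / G.zeta δ s) F (𝓝 (m γ)) :=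
    fun γ => (F.map fun s => G.partialZeta δ s γ / G.zeta δ s).le_nhds_lim
  have hid : Tendsto (fun s : ℝ => s) F (𝓝 δ) := hF.trans nhdsWithin_le_nhds
  have hzeta := (hG.tendsto_zeta hδ hδ1).mono_left hF
  rw [← hG.eq_mass hirr (m := m) ?_ ?_ ?_ hγ]
  · exact hm γ
  · intro γ n hn
    -- The term of γ itself stays bounded while the zeta function tends to infinity, so it drops out
    -- and exact additivity remains.
    have h1 : Tendsto (fun s : ℝ => ENNReal.ofReal (G.weight δ γ ^ s) / G.zeta δ s) F (𝓝 0) := by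
      have hw : Tendsto (fun s : ℝ => ENNReal.ofReal (G.weight δ γ ^ s)) F
          (𝓝 (ENNReal.ofReal (G.weight δ γ ^ δ))) :=
        (ENNReal.continuous_ofReal.tendsto _).comp
          (((Real.continuous_const_rpow (hG.weight_pos δ γ).ne').tendsto δ).comp hid)
      simpa using ENNReal.Tendsto.div hw (Or.inr ENNReal.top_ne_zero) hzeta
        (Or.inr ENNReal.ofReal_ne_top)
    have h2 := h1.add (tendsto_finsetSum Finset.univ
      fun (e : G.PathsTo γ.left (Pi.single (Fin.ofNat k n) 1)) _ => hm (mul γ e.1 e.2.1.symm))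
    rw [zero_add] at h2
    refine tendsto_nhds_unique (hm γ) (h2.congr fun s => ?_)
    let _ : Fintype (G.Edge γ.left (Fin.ofNat k n)) := this γ.left (Pi.single (Fin.ofNat k n) 1)
    rw [partialZeta_eq_add (j := Fin.ofNat k n) δ s hn (rainbow_succ n)]
    simp only [div_eq_mul_inv]
    rw [add_mul, Finset.sum_mul]
    rfl
  · intro γ q hq
    have hR := hG.rhoPow_pos (G.degree γ)
    have hc : Tendsto (fun s : ℝ => ENNReal.ofReal ((G.rhoPow (G.degree γ) ^ (-1 / δ)) ^ s)) F
        (𝓝 (ENNReal.ofReal (G.rhoPow (G.degree γ))⁻¹)) := by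
      have h : (G.rhoPow (G.degree γ))⁻¹ = (G.rhoPow (G.degree γ) ^ (-1 / δ)) ^ δ := by
        rw [← Real.rpow_mul hR.le, div_mul_cancel₀ _ hδ.ne', Real.rpow_neg_one]
      rw [h]
      exact (ENNReal.continuous_ofReal.tendsto _).comp
        (((Real.continuous_const_rpow (Real.rpow_pos_of_pos hR _).ne').tendsto δ).comp hid)
    refine tendsto_nhds_unique (hm γ) ((ENNReal.Tendsto.mul hc
      (Or.inl (ENNReal.ofReal_pos.2 (inv_pos.2 hR)).ne') (hm (vertex γ.left))
      (Or.inr ENNReal.ofReal_ne_top)).congr fun s => ?_)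
    rw [hG.partialZeta_diagonal δ s hq, mul_div_assoc]
  · refine tendsto_nhds_unique (tendsto_finsetSum Finset.univ fun v _ => hm (vertex v))
      (tendsto_const_nhds.congr' ?_)
    -- The quotients at the vertices sum to exactly 1 only where the zeta function is neither 0 nor
    -- ∞; finiteness requires s > δ.
    have hpos := hzeta.eventually_const_lt ENNReal.zero_lt_top
    filter_upwards [hpos, hF self_mem_nhdsWithin] with s h0 hs
    simp only [div_eq_mul_inv]
    rw [← Finset.sum_mul, ← zeta_eq_sum_partialZeta, ENNReal.mul_inv_cancel h0.ne'
      (hG.zeta_lt_top hρ hδ hs).ne]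

theorem isDixmierMeasure_M [NeZero k]
    (hirr : ((G.adjDeg 1).map (Nat.cast : ℕ → ℝ)).IsIrreducible) {δ : ℝ}
    (hδ : 0 < δ) (hδ1 : δ < 1) (hw : G.WeightEqDiam δ) : G.IsDixmierMeasure δ G.M := by
  refine ⟨inferInstance, fun γ hγ => ?_⟩
  rw [measure_cyl hG.pathMeasure]
  exact hG.tendsto_partialZeta_div_zeta hirr (hG.one_lt_rhoPow_one hw) hδ hδ1 hγ

end IsRegular

theorem IsDixmierMeasure.eq {δ : ℝ} {μ ν : Measure G.InfPath} (hμ : G.IsDixmierMeasure δ μ)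
    (hν : G.IsDixmierMeasure δ ν) [NeZero k] : μ = ν := by
  have := hμ.1
  exact measure_ext_rainbow fun γ hγ => tendsto_nhds_unique (hμ.2 γ hγ) (hν.2 γ hγ)

end

end KGraph

theorem mainTheorem10 {k : ℕ} [NeZero k] {C : Type u} [SmallCategory C] [Fintype C]
    [DecidableEq C] [Nonempty C] (G : KGraph k C) (hfin : G.IsFinite) (hsrc : G.HasNoSources)
    (hconn : G.IsStronglyConnected) :
    -- the Perron-Frobenius eigenvector, the measure `M` and the operators `S_p` are well defined
    G.IsPerronFrobenius G.pfVector ∧ G.IsPathMeasure G.M ∧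
    (∀ p : Arrow C, G.IsScalingOperator p (G.S p)) ∧
    ∀ c : G.CoeffFamily, G.IsWaveletCoeff c →
      (∀ j : Fin k, Orthonormal ℂ
        (fun i : G.MotherIndex j => G.mother c j i.base i.idx)) ∧
      (∀ (q : ℕ) (j : Fin k), Orthonormal ℂ
        (fun i : G.WaveletIndex q j => G.S i.path (G.mother c j i.base i.idx))) ∧
      (∀ (q q' : ℕ) (j j' : Fin k), q * k + (j : ℕ) ≠ q' * k + (j' : ℕ) →
        (G.refinedW c q j).IsOrtho (G.refinedW c q' j')) ∧
      IsHilbertSum ℂ (fun o => G.summand c o) (fun o => (G.summand c o).subtypeₗᵢ) ∧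
      (∀ q : ℕ, G.W q = ⨆ j : Fin k, G.refinedW c q j) ∧
      (((List.ofFn G.adj).prod.map (Nat.cast : ℕ → ℝ)).IsIrreducible →
        ∀ δ : ℝ, 0 < δ → δ < 1 → G.WeightEqDiam δ →
          G.IsDixmierMeasure δ (G.dixmierMeasure δ) ∧ G.dixmierMeasure δ = G.M ∧
          ∀ (q : ℕ) (j : Fin k), G.refinedW c q j =
            ⨆ γ ∈ {γ : Arrow C | G.IsRainbow γ ∧ G.length γ = q * k + (j : ℕ)},
              G.eigenspace δ γ) := by
  have hpf := KGraph.isPerronFrobenius_pfVector hfin hconn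
  have hM := KGraph.isPathMeasure_M hfin hsrc hpf
  have hS := KGraph.isScalingOperator_S hfin hsrc hpf hM
  have hG : G.IsRegular := ⟨hfin, hsrc, hpf, hM, hS⟩
  refine ⟨hpf, hM, hS, fun c hc => ⟨hG.orthonormal_mother hc, hG.orthonormal_wavelet hc,
    fun q q' j j' h => hG.refinedW_isOrtho hc h, hG.isHilbertSum hc, hG.W_eq hc,
    fun hirr δ hδ hδ1 hw => ?_⟩⟩
  rw [KGraph.prod_ofFn_adj hfin] at hirr
  have hD := hG.isDixmierMeasure_M hirr hδ hδ1 hw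
  have hex : ∃ μ, G.IsDixmierMeasure δ μ := ⟨G.M, hD⟩
  have hD' : G.IsDixmierMeasure δ (G.dixmierMeasure δ) := by
    rw [KGraph.dixmierMeasure, dif_pos hex]
    exact hex.choose_spec
  -- The chosen measure and `M` have the same limits on the π-system of Bratteli cylinders, so they
  -- coincide.
  have heq := hD'.eq hD
  exact ⟨hD', heq, hG.refinedW_eq_iSup_eigenspace hc heq⟩
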